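/- For a real random variable $S$ and $p\ge 1$ write $\|S\|_p=(\mathbb E|S|^p)^{1/p}$, and let $$\gamma_p=\sqrt2\left(\frac{\Gamma\left(\frac{p+1}{2}\right)}{\sqrt\pi}\right)^{1/p}$$ be the $p$-th moment $\|G\|_p$ of a standard Gaussian random variable $G$. Fix $q\in[2,\infty]$ and let $Y_1,Y_2,\ldots$ be i.i.d. real random variables with density proportional to $e^{-|x|^q}$ (for $q=\infty$: uniformly distributed on $[-1,1]$). Then for all $p\ge1$, $n\ge 1$ and $a_1,\dots,a_n\in\mathbb R$ the moment $\|\sum_{i=1}^n a_iY_i\|_p$ is finite, and the following holds. (1) For every $p\ge 2$, for all $n\ge1$ and all real numbers $a_1,\dots,a_n$, $$\Big\|\sum_{i=1}^n a_iY_i\Big\|_p\le \gamma_p\Big\|\sum_{i=1}^n a_iY_i\Big\|_2,$$ and $\gamma_p$ is the smallest constant for which this holds for all $n\ge1$ and all real $a_1,\dots,a_n$. (2) For every $p\in[1,2]$, for all $n\ge1$ and all real numbers $a_1,\dots,a_n$, $$\Big\|\sum_{i=1}^n a_iY_i\Big\|_p\ge \gamma_p\Big\|\sum_{i=1}^n a_iY_i\Big\|_2,$$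 and $\gamma_p$ is the largest constant for which this holds for all $n\ge1$ and all real $a_1,\dots,a_n$. -/

import Mathlib

open MeasureTheory ProbabilityTheory
open scoped ENNReal

noncomputable section

/-- The function `x ↦ exp (-|x|^q)` on the real line for `q ∈ (0, ∞]`. For `q = ∞` it is read,
as usual, as the limit for `q → ∞`, which is (off the null set `{-1, 1}`) the indicator function
of `[-1, 1]`. -/
def expPowerWeight (q : ℝ≥0∞) (x : ℝ) : ℝ :=
  if q = ∞ then Set.indicator (Set.Icc (-1 : ℝ) 1) (fun _ => 1) x
  else Real.exp (-|x| ^ q.toReal)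

/-- The random variable `X` has a density proportional to `exp (-|x|^q)`. -/
def HasExpPowerDensity {Ω : Type*} [MeasurableSpace Ω] (q : ℝ≥0∞) (X : Ω → ℝ)
    (P : Measure Ω) : Prop :=
  AEMeasurable X P ∧ ∃ c : ℝ, 0 < c ∧
    P.map X = volume.withDensity (fun x => ENNReal.ofReal (c * expPowerWeight q x))

/-- `‖X‖_p = (𝔼 |X|^p)^(1/p)` -/
def momentNorm {Ω : Type*} [MeasurableSpace Ω] (p : ℝ) (X : Ω → ℝ) (P : Measure Ω) : ℝ :=
  (∫ ω, |X ω| ^ p ∂P) ^ (1 / p)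

/-- `γ_p = √2 (Γ((p+1)/2) / √π)^(1/p)` -/
def gaussianMoment (p : ℝ) : ℝ :=
  Real.sqrt 2 * (Real.Gamma ((p + 1) / 2) / Real.sqrt Real.pi) ^ (1 / p)

/-- The constant `γ_p` is the `p`-th moment of a standard Gaussian random variable. -/
theorem gaussianMoment_eq_momentNorm (p : ℝ) (hp : 0 < p) :
    gaussianMoment p = momentNorm p (fun x : ℝ => x) (gaussianReal 0 1) := by
  have h1 : ∫ x : ℝ, |x| ^ p ∂(gaussianReal 0 1) =
      (Real.sqrt 2) ^ p * (Real.Gamma ((p + 1) / 2) / Real.sqrt Real.pi) := by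
    rw [integral_gaussianReal_eq_integral_smul (by norm_num)]
    have h2 : ∀ x : ℝ, gaussianPDFReal 0 1 x • |x| ^ p =
        (fun y : ℝ => (Real.sqrt (2 * Real.pi))⁻¹ * (y ^ p * Real.exp (-(1 / 2) * y ^ (2 : ℝ))))
          |x| := by
      intro x
      simp only [gaussianPDFReal, smul_eq_mul, NNReal.coe_one, mul_one, sub_zero]
      rw [show -x ^ 2 / 2 = -(1 / 2) * |x| ^ (2 : ℝ) by
        rw [Real.rpow_two, sq_abs]; ring]
      ring
    simp_rw [h2]
    rw [integral_comp_abs (f := fun y : ℝ =>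
      (Real.sqrt (2 * Real.pi))⁻¹ * (y ^ p * Real.exp (-(1 / 2) * y ^ (2 : ℝ)))),
      integral_const_mul, integral_rpow_mul_exp_neg_mul_rpow (by norm_num) (by linarith)
        (by norm_num)]
    have h3 : (1 / 2 : ℝ) ^ (-(p + 1) / 2) = Real.sqrt 2 ^ p * Real.sqrt 2 := by
      rw [one_div, Real.inv_rpow (by norm_num), ← Real.rpow_neg (by norm_num),
        Real.sqrt_eq_rpow, ← Real.rpow_mul (by norm_num), ← Real.rpow_add (by norm_num)]
      congr 1
      ring
    rw [h3, Real.sqrt_mul (by norm_num)]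
    have : Real.sqrt 2 ≠ 0 := by positivity
    have : Real.sqrt Real.pi ≠ 0 := by positivity
    field_simp
  have hG : 0 < Real.Gamma ((p + 1) / 2) := Real.Gamma_pos_of_pos (by linarith)
  rw [momentNorm, h1, Real.mul_rpow (by positivity) (by positivity),
    ← Real.rpow_mul (by positivity), mul_one_div_cancel hp.ne', Real.rpow_one, gaussianMoment]

end

/-! The summands are replaced one at a time by centred Gaussians of the same variance, and each
replacement moves the `p`-th moment in a known direction. Two facts make this work.

First, if `S` is symmetric and unimodal, then `t ↦ 𝔼 |√t + S| ^ p` is convex on `[0, ∞)` for `p ≥ 2`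
and concave for `1 < p ≤ 2`. Up to a constant, its derivative at `t = x ^ 2` is the average of `𝔼 |x
v + S| ^ (p - 2)` over `v ∈ [-1, 1]`. Translating a symmetric unimodal law preserves monotonicity in
`|·|`, so this average is monotone in `x` (`ofReal_momentSlope`, `convexOn_integral_abs_sqrt_rpow`,
`concaveOn_integral_abs_sqrt_rpow`).

Second, `𝔼 φ(Y²) ≤ 𝔼 φ(G²)` for convex `φ` and `G` Gaussian with the variance of `Y`. As functions
of `t = x ^ 2`, the log-density of `G` is affine and that of `Y` is concave because `q ≥ 2`, so `Y`
has the larger density on an interval of `t`. Subtracting from `φ` its chord over this interval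
makes the signs match (`integral_comp_sq_mul_le_of_ordConnected`).

Conditioning on all summands but one combines the two facts, and a sum of Gaussians is Gaussian
(`weightedConv_le_gaussianReal`). The case `p = 1` is the limit `p ↓ 1`. Sharpness comes from equal
weights and the central limit theorem, with a Fatou-type inequality for nonnegative continuous test
functions. -/

/-! ### Symmetric unimodal measures -/

/-- `ψ` is a nondecreasing function of `|x|`. -/
def AbsMono (ψ : ℝ → ℝ≥0∞) : Prop := ∀ x y, |x| ≤ |y| → ψ x ≤ ψ y

/-- `ψ` is a nonincreasing function of `|x|`. -/
def AbsAnti (ψ : ℝ → ℝ≥0∞) : Prop := ∀ x y, |x| ≤ |y| → ψ y ≤ ψ x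

/-- Averaging over translates by `ν` preserves monotonicity in `|x|`. -/
structure SymmUnimodal (ν : Measure ℝ) : Prop where
  mono : ∀ ψ, Measurable ψ → AbsMono ψ → AbsMono (fun x => ∫⁻ s, ψ (x + s) ∂ν)
  anti : ∀ ψ, Measurable ψ → AbsAnti ψ → AbsAnti (fun x => ∫⁻ s, ψ (x + s) ∂ν)

theorem ENNReal.mul_add_mul_le_mul_add_mul_of_le {a b c d : ℝ≥0∞} (hab : a ≤ b) (hcd : c ≤ d) :
    a * d + b * c ≤ a * c + b * d := by
  obtain ⟨e, rfl⟩ := exists_add_of_le hcd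
  rw [mul_add, mul_add, add_assoc, add_comm (b * c)]
  gcongr

theorem lintegral_eq_lintegral_Ioi_add_neg {g : ℝ → ℝ≥0∞} (hg : Measurable g) :
    ∫⁻ x, g x = ∫⁻ x in Set.Ioi 0, (g x + g (-x)) := by
  rw [lintegral_add_left hg, ← lintegral_add_compl g (measurableSet_Ioi (a := (0 : ℝ))),
    Set.compl_Ioi]
  congr 1
  have h := (Measure.measurePreserving_neg (volume : Measure ℝ)).setLIntegral_comp_preimage
    (measurableSet_Iio (a := (0 : ℝ))) hg
  rw [setLIntegral_congr Iio_ae_eq_Iic.symm, ← h]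
  simp

/-- Recentring at `s = v + d` and folding `v` onto `-v` leaves the values `ψ (m ± v)` independent of
`d`; only their pairing with `f (v ± d)` changes with the sign of `d`. -/
theorem lintegral_translate_mul_eq {ψ f : ℝ → ℝ≥0∞} (hψ : Measurable ψ) (hf : Measurable f)
    (hfe : ∀ x, f (-x) = f x) (m d : ℝ) :
    ∫⁻ s, ψ (m - d + s) * f s =
      ∫⁻ v in Set.Ioi 0, (ψ (m + v) * f (v + d) + ψ (m - v) * f (v - d)) := by
  rw [← lintegral_add_right_eq_self _ d, lintegral_eq_lintegral_Ioi_add_neg (by fun_prop)]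
  refine lintegral_congr fun v => ?_
  rw [← hfe (-v + d)]
  ring_nf

/-- A rearrangement argument. With `|x| = m - d` and `|y| = m + d`, the folded integrals pair the
ordered values `ψ (m ± v)` with the ordered values `f (v ± d)` in opposite ways, and pairing larger
with larger gives the larger sum for each `v`. -/
theorem symmUnimodal_withDensity {f : ℝ → ℝ≥0∞} (hf : Measurable f) (hfa : AbsAnti f) :
    SymmUnimodal (volume.withDensity f) := by
  have hfe : ∀ x, f (-x) = f x := fun x =>
    le_antisymm (hfa _ _ (by simp)) (hfa _ _ (by simp))
  have hint : ∀ ψ : ℝ → ℝ≥0∞, Measurable ψ → ∀ x,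
      ∫⁻ s, ψ (x + s) ∂(volume.withDensity f) = ∫⁻ s, ψ (x + s) * f s := by
    intro ψ hψ x
    rw [lintegral_withDensity_eq_lintegral_mul _ hf (by fun_prop)]
    exact lintegral_congr fun s => mul_comm _ _
  have heven : ∀ ψ : ℝ → ℝ≥0∞, Measurable ψ → (∀ x, ψ (-x) = ψ x) → ∀ x,
      ∫⁻ s, ψ (|x| + s) * f s = ∫⁻ s, ψ (x + s) * f s := by
    intro ψ hψ he x
    rcases abs_choice x with h | h <;> rw [h]
    rw [← lintegral_neg_eq_self]
    refine lintegral_congr fun s => ?_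
    rw [hfe, ← he]
    ring_nf
  have key : ∀ v d : ℝ, 0 < v → 0 ≤ d → f (v + d) ≤ f (v - d) := by
    intro v d hv hd
    apply hfa
    rw [abs_le, abs_of_nonneg (by linarith)]
    constructor <;> linarith
  have habs : ∀ m v : ℝ, 0 < v → 0 ≤ m → |m - v| ≤ |m + v| := by
    intro m v hv hm
    rw [abs_le, abs_of_nonneg (by linarith)]
    constructor <;> linarith
  have hxy : ∀ x y : ℝ, |x| ≤ |y| → ∃ m d : ℝ, 0 ≤ m ∧ 0 ≤ d ∧ |x| = m - d ∧ |y| = m - -d :=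
    fun x y h => ⟨(|x| + |y|) / 2, (|y| - |x|) / 2, by positivity, by linarith, by ring, by ring⟩
  constructor
  · intro ψ hψ hm x y h
    have he : ∀ x, ψ (-x) = ψ x := fun x =>
      le_antisymm (hm _ _ (by simp)) (hm _ _ (by simp))
    obtain ⟨m, d, hm0, hd, hx, hy⟩ := hxy x y h
    simp only [hint ψ hψ]
    rw [← heven ψ hψ he x, ← heven ψ hψ he y, hx, hy,
      lintegral_translate_mul_eq hψ hf hfe, lintegral_translate_mul_eq hψ hf hfe]
    refine setLIntegral_mono' measurableSet_Ioi fun v hv => ?_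
    have := ENNReal.mul_add_mul_le_mul_add_mul_of_le (hm _ _ (habs _ v hv hm0)) (key v _ hv hd)
    rw [sub_neg_eq_add, ← sub_eq_add_neg]
    rw [add_comm] at this
    rwa [add_comm (ψ _ * f (v - _))]
  · intro ψ hψ hm x y h
    have he : ∀ x, ψ (-x) = ψ x := fun x =>
      le_antisymm (hm _ _ (by simp)) (hm _ _ (by simp))
    obtain ⟨m, d, hm0, hd, hx, hy⟩ := hxy x y h
    simp only [hint ψ hψ]
    rw [← heven ψ hψ he x, ← heven ψ hψ he y, hx, hy,
      lintegral_translate_mul_eq hψ hf hfe, lintegral_translate_mul_eq hψ hf hfe]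
    refine setLIntegral_mono' measurableSet_Ioi fun v hv => ?_
    have := ENNReal.mul_add_mul_le_mul_add_mul_of_le (hm _ _ (habs _ v hv hm0)) (key v _ hv hd)
    rwa [sub_neg_eq_add, ← sub_eq_add_neg]

theorem symmUnimodal_dirac_zero : SymmUnimodal (Measure.dirac 0) := by
  constructor <;> intro ψ hψ h <;> simpa using h

theorem SymmUnimodal.conv {μ ν : Measure ℝ} [SFinite μ] [SFinite ν] (hμ : SymmUnimodal μ)
    (hν : SymmUnimodal ν) : SymmUnimodal (μ ∗ ν) := by
  have hint : ∀ ψ : ℝ → ℝ≥0∞, Measurable ψ → ∀ x, ∫⁻ s, ψ (x + s) ∂(μ ∗ ν) =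
      ∫⁻ a, (fun y => ∫⁻ b, ψ (y + b) ∂ν) (x + a) ∂μ := by
    intro ψ hψ x
    rw [Measure.lintegral_conv (by fun_prop)]
    simp only [add_assoc]
  have hmeas : ∀ ψ : ℝ → ℝ≥0∞, Measurable ψ → Measurable (fun y => ∫⁻ b, ψ (y + b) ∂ν) :=
    fun ψ hψ => Measurable.lintegral_prod_right' (f := fun z : ℝ × ℝ => ψ (z.1 + z.2))
      (by fun_prop)
  constructor
  · intro ψ hψ h
    simp only [hint ψ hψ]
    exact hμ.mono _ (hmeas ψ hψ) (hν.mono ψ hψ h)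
  · intro ψ hψ h
    simp only [hint ψ hψ]
    exact hμ.anti _ (hmeas ψ hψ) (hν.anti ψ hψ h)

theorem SymmUnimodal.map_const_mul {μ : Measure ℝ} [IsProbabilityMeasure μ] (hμ : SymmUnimodal μ)
    (a : ℝ) : SymmUnimodal (μ.map (fun x => a * x)) := by
  rcases eq_or_ne a 0 with rfl | ha
  · simp only [zero_mul, Measure.map_const, measure_univ, one_smul]
    exact symmUnimodal_dirac_zero
  have hint : ∀ ψ : ℝ → ℝ≥0∞, Measurable ψ → ∀ x, ∫⁻ s, ψ (x + s) ∂(μ.map (fun x => a * x)) =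
      ∫⁻ s, (fun y => ψ (a * y)) (a⁻¹ * x + s) ∂μ := by
    intro ψ hψ x
    rw [lintegral_map (by fun_prop) (by fun_prop)]
    refine lintegral_congr fun s => ?_
    simp only [mul_add, mul_inv_cancel_left₀ ha]
  have hsc : ∀ (b : ℝ) {x y : ℝ}, |x| ≤ |y| → |b * x| ≤ |b * y| := fun b x y h => by
    rw [abs_mul, abs_mul]
    gcongr
  constructor
  · intro ψ hψ h x y hxy
    simp only [hint ψ hψ]
    exact hμ.mono (fun y => ψ (a * y)) (by fun_prop) (fun x y h' => h _ _ (hsc a h')) _ _ (hsc _ hxy)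
  · intro ψ hψ h x y hxy
    simp only [hint ψ hψ]
    exact hμ.anti (fun y => ψ (a * y)) (by fun_prop) (fun x y h' => h _ _ (hsc a h')) _ _ (hsc _ hxy)

theorem symmUnimodal_gaussianReal_zero (v : NNReal) : SymmUnimodal (gaussianReal 0 v) := by
  rcases eq_or_ne v 0 with rfl | hv
  · rw [gaussianReal_zero_var]
    exact symmUnimodal_dirac_zero
  rw [gaussianReal_of_var_ne_zero _ hv]
  refine symmUnimodal_withDensity (measurable_gaussianPDF _ _) fun x y h => ?_
  unfold gaussianPDF gaussianPDFReal
  have : x ^ 2 ≤ y ^ 2 := sq_le_sq.2 h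
  simp only [sub_zero]
  gcongr

/-! ### The odd power and averages of `|u| ^ (p - 2)` -/

/-- The odd power `sgn x * |x| ^ (p - 1)`, a multiple of the derivative of `|x| ^ p`. -/
noncomputable def signedPow (p x : ℝ) : ℝ := |x| ^ (p - 2) * x

theorem signedPow_neg (p x : ℝ) : signedPow p (-x) = -signedPow p x := by
  simp [signedPow]

theorem measurable_signedPow (p : ℝ) : Measurable (signedPow p) := by
  unfold signedPow; fun_prop

theorem signedPow_of_nonneg {p : ℝ} (hp : 1 < p) {x : ℝ} (hx : 0 ≤ x) :
    signedPow p x = x ^ (p - 1) := by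
  rcases hx.eq_or_lt with rfl | h
  · simp [signedPow, Real.zero_rpow (by linarith : p - 1 ≠ 0)]
  · rw [signedPow, abs_of_pos h, ← Real.rpow_add_one h.ne']
    congr 1; ring

theorem abs_signedPow {p : ℝ} (hp : 1 < p) (x : ℝ) : |signedPow p x| = |x| ^ (p - 1) := by
  rw [← signedPow_of_nonneg hp (abs_nonneg x)]
  simp [signedPow, abs_mul, abs_of_nonneg (Real.rpow_nonneg (abs_nonneg x) _)]

theorem integral_zero_abs_rpow {p : ℝ} (hp : 1 < p) (b : ℝ) :
    IntervalIntegrable (fun u => |u| ^ (p - 2)) volume 0 b ∧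
      ∫ u in (0 : ℝ)..b, |u| ^ (p - 2) = signedPow p b / (p - 1) := by
  have main : ∀ b : ℝ, 0 ≤ b → IntervalIntegrable (fun u => |u| ^ (p - 2)) volume 0 b ∧
      ∫ u in (0 : ℝ)..b, |u| ^ (p - 2) = signedPow p b / (p - 1) := by
    intro b hb
    have hcongr : Set.EqOn (fun u : ℝ => u ^ (p - 2)) (fun u => |u| ^ (p - 2)) (Set.uIcc 0 b) := by
      intro u hu
      rw [Set.uIcc_of_le hb] at hu
      simp only [abs_of_nonneg hu.1]
    constructor
    · exact (intervalIntegral.intervalIntegrable_rpow' (by linarith)).congr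
        (hcongr.mono Set.uIoc_subset_uIcc)
    · rw [← intervalIntegral.integral_congr hcongr, integral_rpow (Or.inl (by linarith)),
        signedPow_of_nonneg hp hb, Real.zero_rpow (by linarith)]
      ring_nf
  rcases le_total 0 b with hb | hb
  · exact main b hb
  · obtain ⟨h1, h2⟩ := main (-b) (by linarith)
    constructor
    · rw [IntervalIntegrable.iff_comp_neg]
      simpa using h1
    · have := intervalIntegral.integral_comp_neg (a := 0) (b := b) (fun u : ℝ => |u| ^ (p - 2))
      simp only [abs_neg, neg_zero] at this
      rw [this, intervalIntegral.integral_symm, h2, signedPow_neg]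
      ring

theorem intervalIntegrable_abs_rpow {p : ℝ} (hp : 1 < p) (a b : ℝ) :
    IntervalIntegrable (fun u => |u| ^ (p - 2)) volume a b :=
  (integral_zero_abs_rpow hp a).1.symm.trans (integral_zero_abs_rpow hp b).1

theorem integral_abs_rpow {p : ℝ} (hp : 1 < p) (a b : ℝ) :
    ∫ u in a..b, |u| ^ (p - 2) = (signedPow p b - signedPow p a) / (p - 1) := by
  rw [← intervalIntegral.integral_interval_sub_left (integral_zero_abs_rpow hp b).1
    (integral_zero_abs_rpow hp a).1, (integral_zero_abs_rpow hp b).2,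
    (integral_zero_abs_rpow hp a).2]
  ring

theorem lintegral_ofReal_abs_rpow {p : ℝ} (hp : 1 < p) (s : ℝ) {x : ℝ} (hx : 0 < x) :
    ∫⁻ v in Set.Ioc (-1 : ℝ) 1, ENNReal.ofReal |s + x * v| ^ (p - 2) =
      ENNReal.ofReal ((signedPow p (s + x) - signedPow p (s - x)) / ((p - 1) * x)) := by
  -- The two powers can differ only where the base vanishes, that is at `v = -s / x`; there, for `p
  -- < 2`, the extended one is `∞`.
  have h0 : ∀ᵐ v ∂(volume.restrict (Set.Ioc (-1 : ℝ) 1)),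
      ENNReal.ofReal |s + x * v| ^ (p - 2) = ENNReal.ofReal (|s + x * v| ^ (p - 2)) := by
    refine ae_restrict_of_ae ?_
    filter_upwards [Measure.ae_ne volume (-s / x)] with v hv
    rw [ENNReal.ofReal_rpow_of_pos]
    refine abs_pos.2 fun h => hv ?_
    field_simp
    linarith
  have hint : IntervalIntegrable (fun v => |s + x * v| ^ (p - 2)) volume (-1) 1 := by
    have := ((intervalIntegrable_abs_rpow hp (s + x * (-1)) (s + x * 1)).comp_add_left s).comp_mul_left
      (c := x)
    convert this using 1 <;> field_simp <;> ring
  rw [lintegral_congr_ae h0, ← ofReal_integral_eq_lintegral_ofReal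
    ((intervalIntegrable_iff_integrableOn_Ioc_of_le (by norm_num)).1 hint)
    (Filter.Eventually.of_forall fun v => by positivity),
    ← intervalIntegral.integral_of_le (by norm_num),
    intervalIntegral.integral_comp_add_mul (fun u => |u| ^ (p - 2)) hx.ne' s, integral_abs_rpow hp]
  congr 1
  have : p - 1 ≠ 0 := by linarith
  simp only [smul_eq_mul, mul_one, mul_neg, ← sub_eq_add_neg]
  field_simp

theorem signedPow_sub_nonneg {p : ℝ} (hp : 1 < p) (s : ℝ) {x : ℝ} (hx : 0 ≤ x) :
    0 ≤ signedPow p (s + x) - signedPow p (s - x) := by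
  have h := integral_abs_rpow hp (s - x) (s + x)
  have h2 : 0 ≤ ∫ u in (s - x)..(s + x), |u| ^ (p - 2) :=
    intervalIntegral.integral_nonneg (by linarith) fun u _ => by positivity
  rw [h] at h2
  by_contra hcon
  have : (signedPow p (s + x) - signedPow p (s - x)) / (p - 1) < 0 :=
    div_neg_of_neg_of_pos (not_le.1 hcon) (by linarith)
  linarith

/-! ### Convexity and concavity of `t ↦ 𝔼 |√t + S| ^ p` -/

section moments

variable {ν : Measure ℝ} {p : ℝ}

theorem integral_abs_rpow_eq_toReal (hp : 0 ≤ p) (x : ℝ) :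
    ∫ s, |x + s| ^ p ∂ν = (∫⁻ s, ENNReal.ofReal |x + s| ^ p ∂ν).toReal := by
  rw [integral_eq_lintegral_of_nonneg_ae (Filter.Eventually.of_forall fun s => by positivity)
    (Measurable.aestronglyMeasurable (by fun_prop))]
  congr 1
  exact lintegral_congr fun s => (ENNReal.ofReal_rpow_of_nonneg (abs_nonneg _) hp).symm

/-- Up to a constant factor, the derivative of `t ↦ 𝔼 |√t + S| ^ p` at `t = x ^ 2`. -/
noncomputable def momentSlope (p : ℝ) (ν : Measure ℝ) (x : ℝ) : ℝ :=
  ∫ s, (signedPow p (s + x) - signedPow p (s - x)) / ((p - 1) * x) ∂ν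

theorem momentSlope_nonneg (hp : 1 < p) {x : ℝ} (hx : 0 < x) : 0 ≤ momentSlope p ν x :=
  integral_nonneg fun s => div_nonneg (signedPow_sub_nonneg hp s hx.le)
    (mul_nonneg (by linarith) hx.le)

theorem AbsMono.even {f : ℝ → ℝ≥0∞} (h : AbsMono f) (x : ℝ) : f (-x) = f x :=
  le_antisymm (h _ _ (by simp)) (h _ _ (by simp))

theorem absMono_rpow (hp : 0 ≤ p) : AbsMono (fun u => ENNReal.ofReal |u| ^ p) := fun x y h => by
  dsimp only
  gcongr

/-- The extended power matters here: for `p < 0` it is `∞` at `0`, whereas the real power would be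
`0` and break monotonicity. -/
theorem absAnti_rpow (hp : p ≤ 0) : AbsAnti (fun u => ENNReal.ofReal |u| ^ p) := fun x y h => by
  dsimp only
  rw [← neg_neg p, ENNReal.rpow_neg, ENNReal.rpow_neg _ (-p), ENNReal.inv_le_inv]
  have : 0 ≤ -p := by linarith
  gcongr

theorem integrable_abs_rpow_of_memLp {α : Type*} [MeasurableSpace α] {P : Measure α} {X : α → ℝ}
    (hp : 0 < p) (h : MemLp X (ENNReal.ofReal p) P) : Integrable (fun s => |X s| ^ p) P := by
  have := h.integrable_norm_rpow (by simpa using hp) (by simp)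
  simpa [ENNReal.toReal_ofReal hp.le] using this

theorem integral_abs_rpow_neg (hν : SymmUnimodal ν) (hp : 0 ≤ p) (x : ℝ) :
    ∫ s, |(-x) + s| ^ p ∂ν = ∫ s, |x + s| ^ p ∂ν := by
  rw [integral_abs_rpow_eq_toReal hp, integral_abs_rpow_eq_toReal hp]
  congr 1
  exact (hν.mono _ (by fun_prop) (absMono_rpow hp)).even x

variable [IsProbabilityMeasure ν]

theorem memLp_const_add (hm : MemLp (fun s => s) (ENNReal.ofReal p) ν) (x : ℝ) :
    MemLp (fun s => x + s) (ENNReal.ofReal p) ν := by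
  exact (memLp_const x).add hm

theorem integrable_signedPow (hp : 1 < p) (hm : MemLp (fun s => s) (ENNReal.ofReal p) ν)
    (x : ℝ) : Integrable (fun s => signedPow p (x + s)) ν := by
  have h2 : MemLp (fun s => x + s) (ENNReal.ofReal (p - 1)) ν :=
    (memLp_const_add hm x).mono_exponent (ENNReal.ofReal_le_ofReal (by linarith))
  have h3 := integrable_abs_rpow_of_memLp (by linarith) h2
  refine h3.mono ((measurable_signedPow p).comp (by fun_prop)).aestronglyMeasurable ?_
  refine Filter.Eventually.of_forall fun s => ?_
  rw [Real.norm_eq_abs, abs_signedPow hp]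
  exact le_abs_self _

theorem hasDerivAt_integral_abs_rpow (hp : 1 < p)
    (hm : MemLp (fun s => s) (ENNReal.ofReal p) ν) (x : ℝ) :
    HasDerivAt (fun x => ∫ s, |x + s| ^ p ∂ν) (∫ s, p * signedPow p (x + s) ∂ν) x := by
  have hb : Integrable (fun s => p * ((|x| + 1) + |s|) ^ (p - 1)) ν := by
    have h1 : MemLp (fun s => (|x| + 1) + |s|) (ENNReal.ofReal p) ν :=
      (memLp_const (|x| + 1)).add hm.norm
    have h1' : MemLp (fun s => (|x| + 1) + |s|) (ENNReal.ofReal (p - 1)) ν :=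
      h1.mono_exponent (ENNReal.ofReal_le_ofReal (by linarith))
    have h2 := integrable_abs_rpow_of_memLp (by linarith) h1'
    refine (h2.const_mul p).congr (Filter.Eventually.of_forall fun s => ?_)
    simp only
    rw [abs_of_nonneg (a := |x| + 1 + |s|) (by positivity)]
  refine (hasDerivAt_integral_of_dominated_loc_of_deriv_le (Metric.ball_mem_nhds x one_pos)
    (F := fun x s => |x + s| ^ p) (F' := fun x s => p * signedPow p (x + s))
    (Filter.Eventually.of_forall fun y => ?_) ?_ ?_ (Filter.Eventually.of_forall fun s y hy => ?_)
    hb (Filter.Eventually.of_forall fun s y _ => ?_)).2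
  · exact Measurable.aestronglyMeasurable (by fun_prop)
  · exact integrable_abs_rpow_of_memLp (by linarith) (memLp_const_add hm x)
  · exact ((integrable_signedPow hp hm x).const_mul p).aestronglyMeasurable
  · rw [norm_mul, Real.norm_eq_abs, Real.norm_eq_abs, abs_signedPow hp, abs_of_pos (by linarith)]
    have h1 : |y| ≤ |x| + 1 := by
      have := abs_sub_abs_le_abs_sub y x
      have h2 : |y - x| < 1 := by simpa [Real.dist_eq] using hy
      linarith
    have h3 : |y + s| ≤ |x| + 1 + |s| := (abs_add_le y s).trans (by linarith)
    have : 0 ≤ p - 1 := by linarith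
    gcongr
  · have := (hasDerivAt_abs_rpow (y + s) hp).comp_add_const y s
    simpa [signedPow, mul_assoc] using this

theorem hasDerivAt_integral_abs_sqrt_rpow (hν : SymmUnimodal ν) (hp : 1 < p)
    (hm : MemLp (fun s => s) (ENNReal.ofReal p) ν) {t : ℝ} (ht : 0 < t) :
    HasDerivAt (fun t => ∫ s, |√t + s| ^ p ∂ν) (p * (p - 1) / 4 * momentSlope p ν √t) t := by
  have hst : 0 < √t := Real.sqrt_pos.2 ht
  have h1 := hasDerivAt_integral_abs_rpow hp hm √t
  have h2 := (hasDerivAt_integral_abs_rpow hp hm (-√t)).scomp √t (hasDerivAt_neg √t)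
  have h3 := (h1.add h2).const_mul (1 / 2)
  -- The moment is even in `x`, so it equals its average over `±x`; differentiating that average
  -- produces the difference of odd powers in `momentSlope`.
  have h4 : (fun x => 1 / 2 * ((fun x => ∫ s, |x + s| ^ p ∂ν) +
      (fun x => ∫ s, |x + s| ^ p ∂ν) ∘ Neg.neg) x) = fun x => ∫ s, |x + s| ^ p ∂ν := by
    funext x
    simp only [Pi.add_apply, Function.comp]
    rw [integral_abs_rpow_neg hν (by linarith)]
    ring
  rw [h4] at h3
  refine (h3.comp t (Real.hasDerivAt_sqrt ht.ne')).congr_deriv ?_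
  have hi1 := integrable_signedPow hp hm √t
  have hi2 := integrable_signedPow hp hm (-√t)
  have : momentSlope p ν √t =
      ((∫ s, signedPow p (√t + s) ∂ν) - ∫ s, signedPow p (-√t + s) ∂ν) / ((p - 1) * √t) := by
    rw [momentSlope, integral_div, ← integral_sub hi1 hi2]
    congr 1
    refine integral_congr_ae (Filter.Eventually.of_forall fun s => ?_)
    simp only
    congr 2 <;> ring
  rw [this, integral_const_mul, integral_const_mul]
  have : p - 1 ≠ 0 := by linarith
  simp only [smul_eq_mul]
  field_simp
  ring

/-- By Tonelli the slope becomes an average over `v` of integrals of `|· + s| ^ (p - 2)` at `x * v`,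
to which `SymmUnimodal` applies pointwise in `v`. -/
theorem ofReal_momentSlope (hp : 1 < p) (hm : MemLp (fun s => s) (ENNReal.ofReal p) ν)
    {x : ℝ} (hx : 0 < x) :
    ENNReal.ofReal (momentSlope p ν x) =
      ∫⁻ v in Set.Ioc (-1 : ℝ) 1, ∫⁻ s, ENNReal.ofReal |x * v + s| ^ (p - 2) ∂ν := by
  have hp1 : 0 < p - 1 := by linarith
  have hi1 := integrable_signedPow hp hm x
  have hi2 := integrable_signedPow hp hm (-x)
  rw [momentSlope, ofReal_integral_eq_lintegral_ofReal, lintegral_lintegral_swap]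
  · refine lintegral_congr fun s => ?_
    rw [← lintegral_ofReal_abs_rpow hp s hx]
    simp only [add_comm]
  · exact Measurable.aemeasurable (by fun_prop)
  · refine ((hi1.sub hi2).div_const ((p - 1) * x)).congr (Filter.Eventually.of_forall fun s => ?_)
    simp only [Pi.sub_apply]
    congr 3 <;> ring
  · refine Filter.Eventually.of_forall fun s => ?_
    exact div_nonneg (signedPow_sub_nonneg hp s hx.le) (by positivity)

theorem momentSlope_monotoneOn (hν : SymmUnimodal ν) (hp : 2 ≤ p)
    (hm : MemLp (fun s => s) (ENNReal.ofReal p) ν) :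
    MonotoneOn (momentSlope p ν) (Set.Ioi 0) := by
  intro x hx y hy hxy
  rw [← ENNReal.ofReal_le_ofReal_iff (momentSlope_nonneg (by linarith) hy),
    ofReal_momentSlope (by linarith) hm hx, ofReal_momentSlope (by linarith) hm hy]
  refine lintegral_mono fun v => ?_
  refine hν.mono _ (by fun_prop) (absMono_rpow (by linarith)) _ _ ?_
  rw [abs_mul, abs_mul, abs_of_pos (a := x) hx, abs_of_pos (a := y) hy]
  gcongr

theorem momentSlope_antitoneOn (hν : SymmUnimodal ν) (hp : 1 < p) (hp2 : p ≤ 2)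
    (hm : MemLp (fun s => s) (ENNReal.ofReal p) ν) :
    AntitoneOn (momentSlope p ν) (Set.Ioi 0) := by
  intro x hx y hy hxy
  rw [← ENNReal.ofReal_le_ofReal_iff (momentSlope_nonneg (by linarith) hx),
    ofReal_momentSlope (by linarith) hm hx, ofReal_momentSlope (by linarith) hm hy]
  refine lintegral_mono fun v => ?_
  refine hν.anti _ (by fun_prop) (absAnti_rpow (by linarith)) _ _ ?_
  rw [abs_mul, abs_mul, abs_of_pos (a := x) hx, abs_of_pos (a := y) hy]
  gcongr

theorem convexOn_integral_abs_sqrt_rpow (hν : SymmUnimodal ν) (hp : 2 ≤ p)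
    (hm : MemLp (fun s => s) (ENNReal.ofReal p) ν) :
    ConvexOn ℝ (Set.Ici 0) (fun t => ∫ s, |√t + s| ^ p ∂ν) := by
  have hd := fun (t : ℝ) ht => hasDerivAt_integral_abs_sqrt_rpow hν (by linarith : 1 < p) hm
    (t := t) ht
  have hc : Continuous fun t : ℝ => ∫ s, |√t + s| ^ p ∂ν :=
    (continuous_iff_continuousAt.2 fun x =>
      (hasDerivAt_integral_abs_rpow (by linarith) hm x).continuousAt).comp Real.continuous_sqrt
  refine MonotoneOn.convexOn_of_deriv (convex_Ici 0) hc.continuousOn ?_ ?_ <;>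
    rw [interior_Ici]
  · exact fun t ht => (hd t ht).differentiableAt.differentiableWithinAt
  · intro t ht u hu htu
    rw [(hd t ht).deriv, (hd u hu).deriv]
    exact mul_le_mul_of_nonneg_left (momentSlope_monotoneOn hν hp hm (Real.sqrt_pos.2 ht)
      (Real.sqrt_pos.2 hu) (Real.sqrt_le_sqrt htu)) (by nlinarith)

theorem concaveOn_integral_abs_sqrt_rpow (hν : SymmUnimodal ν) (hp : 1 < p) (hp2 : p ≤ 2)
    (hm : MemLp (fun s => s) (ENNReal.ofReal p) ν) :
    ConcaveOn ℝ (Set.Ici 0) (fun t => ∫ s, |√t + s| ^ p ∂ν) := by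
  have hd := fun (t : ℝ) ht => hasDerivAt_integral_abs_sqrt_rpow hν hp hm (t := t) ht
  have hc : Continuous fun t : ℝ => ∫ s, |√t + s| ^ p ∂ν :=
    (continuous_iff_continuousAt.2 fun x =>
      (hasDerivAt_integral_abs_rpow (by linarith) hm x).continuousAt).comp Real.continuous_sqrt
  refine AntitoneOn.concaveOn_of_deriv (convex_Ici 0) hc.continuousOn ?_ ?_ <;>
    rw [interior_Ici]
  · exact fun t ht => (hd t ht).differentiableAt.differentiableWithinAt
  · intro t ht u hu htu
    rw [(hd t ht).deriv, (hd u hu).deriv]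
    exact mul_le_mul_of_nonneg_left (momentSlope_antitoneOn hν hp hp2 hm (Real.sqrt_pos.2 ht)
      (Real.sqrt_pos.2 hu) (Real.sqrt_le_sqrt htu)) (by nlinarith)

end moments

/-! ### Comparison of densities that cross twice -/

theorem ConvexOn.exists_affine_crossing {φ : ℝ → ℝ} {s : Set ℝ} (hφ : ConvexOn ℝ s φ) {t₁ t₂ : ℝ}
    (h₁ : t₁ ∈ s) (h₂ : t₂ ∈ s) (h : t₁ < t₂) :
    ∃ α β : ℝ, (∀ t ∈ s, t ≤ t₁ → 0 ≤ φ t - (α + β * t)) ∧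
      (∀ t, t₁ ≤ t → t ≤ t₂ → φ t - (α + β * t) ≤ 0) ∧
      (∀ t ∈ s, t₂ ≤ t → 0 ≤ φ t - (α + β * t)) := by
  obtain ⟨β, hβ⟩ : ∃ β, β * (t₂ - t₁) = φ t₂ - φ t₁ :=
    ⟨_, div_mul_cancel₀ _ (sub_pos.2 h).ne'⟩
  have hpos : 0 < t₂ - t₁ := sub_pos.2 h
  have key : ∀ t, (t₂ - t₁) * (φ t - (φ t₁ - β * t₁ + β * t)) =
      (t₂ - t₁) * φ t - (t₂ - t) * φ t₁ - (t - t₁) * φ t₂ := by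
    intro t
    linear_combination (-(t - t₁)) * hβ
  refine ⟨φ t₁ - β * t₁, β, fun t ht htt => ?_, fun t ht1 ht2 => ?_, fun t ht htt => ?_⟩
  · rcases htt.eq_or_lt with rfl | hlt
    · linarith
    have := hφ.secant_mono_aux1 ht h₂ hlt h
    refine (mul_nonneg_iff_of_pos_left hpos).1 ?_
    rw [key]
    linarith
  · rcases ht1.eq_or_lt with rfl | hlt
    · linarith
    rcases ht2.eq_or_lt with rfl | hlt2
    · refine nonpos_of_mul_nonpos_right (a := t - t₁) ?_ hpos
      rw [key]
      linarith
    have := hφ.secant_mono_aux1 h₁ h₂ hlt hlt2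
    refine nonpos_of_mul_nonpos_right (a := t₂ - t₁) ?_ hpos
    rw [key]
    linarith
  · rcases htt.eq_or_lt with rfl | hlt
    · refine (mul_nonneg_iff_of_pos_left hpos).1 ?_
      rw [key]
      linarith
    have := hφ.secant_mono_aux1 h₁ ht h hlt
    refine (mul_nonneg_iff_of_pos_left hpos).1 ?_
    rw [key]
    linarith

theorem integral_comp_sq_mul_le_of_ordConnected {f g φ : ℝ → ℝ}
    (hfe : ∀ x, f |x| = f x) (hge : ∀ x, g |x| = g x)
    (hf : Integrable f) (hg : Integrable g)
    (hf2 : Integrable fun x => x ^ 2 * f x) (hg2 : Integrable fun x => x ^ 2 * g x)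
    (h0 : ∫ x, f x = ∫ x, g x) (h2 : ∫ x, x ^ 2 * f x = ∫ x, x ^ 2 * g x)
    (hA : Set.OrdConnected {t : ℝ | 0 ≤ t ∧ g √t ≤ f √t})
    (hφ : ConvexOn ℝ (Set.Ici 0) φ) (hφf : Integrable fun x => φ (x ^ 2) * f x)
    (hφg : Integrable fun x => φ (x ^ 2) * g x) :
    ∫ x, φ (x ^ 2) * f x ≤ ∫ x, φ (x ^ 2) * g x := by
  set A : Set ℝ := {t : ℝ | 0 ≤ t ∧ g √t ≤ f √t} with hAdef
  have hmem : ∀ x : ℝ, x ^ 2 ∈ A ↔ g x ≤ f x := by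
    intro x
    simp only [hAdef, Set.mem_ofPred_eq, Real.sqrt_sq_eq_abs, hfe, hge]
    exact ⟨fun h => h.2, fun h => ⟨sq_nonneg x, h⟩⟩
  have hnull : ∀ t : ℝ, ∀ᵐ x : ℝ, x ^ 2 ≠ t := by
    intro t
    filter_upwards [Measure.ae_ne volume √t, Measure.ae_ne volume (-√t)] with x hx hx' h
    have : |x| = √t := by rw [← h, Real.sqrt_sq_eq_abs]
    rcases abs_choice x with hc | hc
    · exact hx (by rw [← this, hc])
    · exact hx' (by rw [← this, hc, neg_neg])
  -- Equal masses and equal second moments: affine functions of `x ^ 2` do not see the difference of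
  -- the densities.
  have haff : ∀ α β : ℝ, Integrable (fun x => (α + β * x ^ 2) * (g x - f x)) ∧
      ∫ x, (α + β * x ^ 2) * (g x - f x) = 0 := by
    intro α β
    have h : (fun x => (α + β * x ^ 2) * (g x - f x)) = fun x =>
        α * (g x - f x) + β * (x ^ 2 * g x - x ^ 2 * f x) := by
      funext x; ring
    rw [h]
    have i1 : Integrable fun x => α * (g x - f x) := (hg.sub hf).const_mul α
    have i2 : Integrable fun x => β * (x ^ 2 * g x - x ^ 2 * f x) :=
      (hg2.sub hf2).const_mul β
    refine ⟨i1.add i2, ?_⟩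
    rw [integral_add i1 i2, integral_const_mul, integral_const_mul]
    rw [integral_sub hg hf, integral_sub hg2 hf2, h0, h2]
    ring
  -- Degenerate configurations: if some affine function of `x ^ 2` matches the sign of `g - f`, its
  -- zero integral forces `f = g` almost everywhere.
  have hdeg : ∀ α β : ℝ, (∀ᵐ x : ℝ, 0 ≤ (α + β * x ^ 2) * (g x - f x)) →
      (∀ᵐ x : ℝ, α + β * x ^ 2 ≠ 0) → ∫ x, φ (x ^ 2) * f x ≤ ∫ x, φ (x ^ 2) * g x := by
    intro α β h1 h2
    have h3 := (integral_eq_zero_iff_of_nonneg_ae h1 (haff α β).1).1 (haff α β).2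
    refine le_of_eq (integral_congr_ae ?_)
    filter_upwards [h2, h3] with x hx hx3
    have : g x - f x = 0 := (mul_eq_zero.1 hx3).resolve_left hx
    rw [sub_eq_zero.1 this]
  have hsub0 : ∀ t ∈ A, 0 ≤ t := fun t ht => ht.1
  rcases A.subsingleton_or_nontrivial with hs | hnt
  · refine hdeg 1 0 ?_ (Filter.Eventually.of_forall fun x => by simp)
    have : ∃ t₀, A ⊆ {t₀} := by
      rcases hs.eq_empty_or_singleton with h | ⟨t, h⟩
      · exact ⟨0, by simp [h]⟩
      · exact ⟨t, h.subset⟩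
    obtain ⟨t₀, ht₀⟩ := this
    filter_upwards [hnull t₀] with x hx
    have : x ^ 2 ∉ A := fun h => hx (ht₀ h)
    rw [hmem] at this
    linarith
  have hne : A.Nonempty := hnt.nonempty
  have hbb : BddBelow A := ⟨0, hsub0⟩
  -- In the bounded case the chord of `φ` over `[sInf A, sSup A]` is subtracted. In the unbounded
  -- case `g - f` changes sign only at `sInf A`, so `sInf A - t` is the affine function for `hdeg`.
  by_cases hba : BddAbove A
  · have hlt : sInf A < sSup A := by
      obtain ⟨a, ha, b, hb, hab⟩ := hnt.exists_lt
      exact (csInf_le hbb ha).trans_lt (hab.trans_le (le_csSup hba hb))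
    have h10 : 0 ≤ sInf A := le_csInf hne hsub0
    obtain ⟨α, β, hl, hm, hr⟩ := hφ.exists_affine_crossing (Set.mem_Ici.2 h10)
      (Set.mem_Ici.2 (h10.trans hlt.le)) hlt
    have hnn : ∀ x, 0 ≤ φ (x ^ 2) * g x - φ (x ^ 2) * f x -
        (α + β * x ^ 2) * (g x - f x) := by
      intro x
      have : φ (x ^ 2) * g x - φ (x ^ 2) * f x - (α + β * x ^ 2) * (g x - f x) =
        (φ (x ^ 2) - (α + β * x ^ 2)) * (g x - f x) := by ring
      rw [this]
      by_cases hx : x ^ 2 ∈ A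
      · exact mul_nonneg_of_nonpos_of_nonpos (hm _ (csInf_le hbb hx) (le_csSup hba hx))
          (sub_nonpos.2 ((hmem x).1 hx))
      · have hk : 0 ≤ g x - f x := by
          rw [hmem] at hx
          linarith
        rcases le_or_gt (x ^ 2) (sInf A) with h1 | h1
        · exact mul_nonneg (hl _ (sq_nonneg x) h1) hk
        rcases le_or_gt (sSup A) (x ^ 2) with h2 | h2
        · exact mul_nonneg (hr _ (sq_nonneg x) h2) hk
        obtain ⟨a, ha, hax⟩ := exists_lt_of_csInf_lt hne h1
        obtain ⟨b, hb, hbx⟩ := exists_lt_of_lt_csSup hne h2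
        exact absurd (hA.out ha hb ⟨hax.le, hbx.le⟩) hx
    have h := integral_nonneg (μ := volume) (Pi.le_def.2 hnn)
    have hi : Integrable fun x => φ (x ^ 2) * g x - φ (x ^ 2) * f x := hφg.sub hφf
    rw [integral_sub hi (haff α β).1, (haff α β).2, integral_sub hφg hφf] at h
    linarith
  · refine hdeg (sInf A) (-1) (Filter.Eventually.of_forall fun x => ?_) ?_
    · rcases lt_trichotomy (x ^ 2) (sInf A) with h1 | h1 | h1
      · have : x ^ 2 ∉ A := fun h => absurd (csInf_le hbb h) (not_le.2 h1)
        rw [hmem] at this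
        exact mul_nonneg (by linarith) (by linarith)
      · rw [← h1]
        simp
      · obtain ⟨a, ha, hax⟩ := exists_lt_of_csInf_lt hne h1
        obtain ⟨b, hb, hbx⟩ := not_bddAbove_iff.1 hba (x ^ 2)
        have := (hmem x).1 (hA.out ha hb ⟨hax.le, hbx.le⟩)
        exact mul_nonneg_of_nonpos_of_nonpos (by linarith) (by linarith)
    · filter_upwards [hnull (sInf A)] with x hx h
      exact hx (by linarith)

/-! ### The density `exp (-|x|^q)` against the Gaussian -/

/-- `𝔼 φ(X²) ≤ 𝔼 φ(Y²)` for all convex `φ`, where `X` has law `μ` and `Y` has law `γ`. -/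
def SqConvexLE (μ γ : Measure ℝ) : Prop :=
  ∀ φ : ℝ → ℝ, ConvexOn ℝ (Set.Ici 0) φ → Integrable (fun x => φ (x ^ 2)) μ →
    Integrable (fun x => φ (x ^ 2)) γ → ∫ x, φ (x ^ 2) ∂μ ≤ ∫ x, φ (x ^ 2) ∂γ

theorem integrable_withDensity_ofReal_iff {f g : ℝ → ℝ} (hf : Measurable f) (hf0 : ∀ x, 0 ≤ f x) :
    Integrable g (volume.withDensity fun x => ENNReal.ofReal (f x)) ↔
      Integrable fun x => g x * f x := by
  rw [integrable_withDensity_iff_integrable_smul' (by fun_prop) (by simp)]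
  simp only [ENNReal.toReal_ofReal (hf0 _), smul_eq_mul, mul_comm]

theorem integral_withDensity_ofReal {f g : ℝ → ℝ} (hf : Measurable f) (hf0 : ∀ x, 0 ≤ f x) :
    ∫ x, g x ∂(volume.withDensity fun x => ENNReal.ofReal (f x)) = ∫ x, g x * f x := by
  rw [integral_withDensity_eq_integral_toReal_smul (by fun_prop) (by simp)]
  simp only [ENNReal.toReal_ofReal (hf0 _), smul_eq_mul, mul_comm]

theorem sqConvexLE_of_ordConnected {μ γ : Measure ℝ} [IsProbabilityMeasure μ]
    [IsProbabilityMeasure γ] {f g : ℝ → ℝ} (hf : Measurable f) (hf0 : ∀ x, 0 ≤ f x)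
    (hg : Measurable g) (hg0 : ∀ x, 0 ≤ g x)
    (hμ : μ = volume.withDensity fun x => ENNReal.ofReal (f x))
    (hγ : γ = volume.withDensity fun x => ENNReal.ofReal (g x))
    (hfe : ∀ x, f |x| = f x) (hge : ∀ x, g |x| = g x)
    (hμ2 : Integrable (fun x => x ^ 2) μ) (hγ2 : Integrable (fun x => x ^ 2) γ)
    (h2 : ∫ x, x ^ 2 ∂μ = ∫ x, x ^ 2 ∂γ)
    (hA : Set.OrdConnected {t : ℝ | 0 ≤ t ∧ g √t ≤ f √t}) : SqConvexLE μ γ := by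
  intro φ hφ hφμ hφγ
  have i1 : Integrable (fun _ => (1 : ℝ)) μ := integrable_const _
  have i2 : Integrable (fun _ => (1 : ℝ)) γ := integrable_const _
  have h0 : ∫ _, (1 : ℝ) ∂μ = ∫ _, (1 : ℝ) ∂γ := by simp
  subst hμ hγ
  rw [integrable_withDensity_ofReal_iff hf hf0] at i1 hμ2 hφμ
  rw [integrable_withDensity_ofReal_iff hg hg0] at i2 hγ2 hφγ
  rw [integral_withDensity_ofReal hf hf0, integral_withDensity_ofReal hg hg0] at *
  simp only [one_mul] at i1 i2 h0
  exact integral_comp_sq_mul_le_of_ordConnected hfe hge i1 i2 hμ2 hγ2 h0 h2 hA hφ hφμ hφγ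

section weight

variable {q : ℝ≥0∞}

theorem expPowerWeight_nonneg (x : ℝ) : 0 ≤ expPowerWeight q x := by
  unfold expPowerWeight
  split_ifs
  · exact Set.indicator_nonneg (fun _ _ => zero_le_one) _
  · positivity

theorem measurable_expPowerWeight : Measurable (expPowerWeight q) := by
  unfold expPowerWeight
  split_ifs
  · exact measurable_const.indicator measurableSet_Icc
  · fun_prop

theorem expPowerWeight_top (x : ℝ) : expPowerWeight ∞ x = if |x| ≤ 1 then 1 else 0 := by
  simp only [expPowerWeight, if_true, Set.indicator_apply, Set.mem_Icc, abs_le]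

theorem expPowerWeight_anti {x y : ℝ} (h : |x| ≤ |y|) :
    expPowerWeight q y ≤ expPowerWeight q x := by
  by_cases hq : q = ∞
  · subst hq
    rw [expPowerWeight_top, expPowerWeight_top]
    split_ifs <;> linarith
  · simp only [expPowerWeight, hq, if_false]
    gcongr

theorem expPowerWeight_abs (x : ℝ) : expPowerWeight q |x| = expPowerWeight q x :=
  le_antisymm (expPowerWeight_anti (by simp)) (expPowerWeight_anti (by simp))

theorem two_le_toReal (hq : 2 ≤ q) (hq' : q ≠ ∞) : 2 ≤ q.toReal := by
  simpa using ENNReal.toReal_mono hq' hq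

/-- A Gaussian bound uniform in `q`, including `q = ∞`, which supplies all moments at once. -/
theorem expPowerWeight_le (hq : 2 ≤ q) (x : ℝ) :
    expPowerWeight q x ≤ Real.exp 1 * Real.exp (-x ^ 2) := by
  rw [← Real.exp_add]
  by_cases h : q = ∞
  · subst h
    rw [expPowerWeight_top]
    split_ifs with hx
    · rw [Real.one_le_exp_iff]
      have := (sq_le_one_iff_abs_le_one x).2 hx
      linarith
    · positivity
  · simp only [expPowerWeight, h, if_false]
    refine Real.exp_le_exp.2 ?_
    rcases le_total |x| 1 with hx | hx
    · have := (sq_le_one_iff_abs_le_one x).2 hx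
      have h2 : 0 ≤ |x| ^ q.toReal := by positivity
      linarith
    · have := Real.rpow_le_rpow_of_exponent_le hx (two_le_toReal hq h)
      rw [Real.rpow_two, sq_abs] at this
      linarith

theorem withDensity_expPowerWeight_le (hq : 2 ≤ q) {c : ℝ} (hc : 0 < c) :
    ∃ C : ℝ≥0∞, C ≠ ∞ ∧ volume.withDensity (fun x => ENNReal.ofReal (c * expPowerWeight q x)) ≤
      C • gaussianReal 0 (1 / 2) := by
  refine ⟨ENNReal.ofReal (c * Real.exp 1 * √Real.pi), ENNReal.ofReal_ne_top, ?_⟩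
  rw [gaussianReal_of_var_ne_zero _ (by norm_num), ← withDensity_smul _ (by fun_prop)]
  refine withDensity_mono (Filter.Eventually.of_forall fun x => ?_)
  simp only [Pi.smul_apply, smul_eq_mul, gaussianPDF, gaussianPDFReal]
  rw [← ENNReal.ofReal_mul (by positivity)]
  refine ENNReal.ofReal_le_ofReal ?_
  have h1 := expPowerWeight_le hq x
  have h2 : √Real.pi ≠ 0 := by positivity
  push_cast
  calc c * expPowerWeight q x ≤ c * (Real.exp 1 * Real.exp (-x ^ 2)) := by gcongr
    _ = _ := by
      rw [show 2 * Real.pi * (1 / 2) = Real.pi by ring, sub_zero,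
        show -x ^ 2 / (2 * (1 / 2)) = -x ^ 2 by ring]
      field_simp

theorem memLp_withDensity_expPowerWeight (hq : 2 ≤ q) {c : ℝ} (hc : 0 < c) (p : NNReal) :
    MemLp (fun x : ℝ => x) p
      (volume.withDensity (fun x => ENNReal.ofReal (c * expPowerWeight q x))) := by
  obtain ⟨C, hC, h⟩ := withDensity_expPowerWeight_le hq hc
  exact (memLp_id_gaussianReal p).of_measure_le_smul hC h

theorem symmUnimodal_withDensity_expPowerWeight {c : ℝ} (hc : 0 < c) :
    SymmUnimodal (volume.withDensity (fun x => ENNReal.ofReal (c * expPowerWeight q x))) := by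
  refine symmUnimodal_withDensity ?_ fun x y h => ENNReal.ofReal_le_ofReal ?_
  · exact (measurable_expPowerWeight.const_mul c).ennreal_ofReal
  · exact mul_le_mul_of_nonneg_left (expPowerWeight_anti h) hc.le

/-- After taking logarithms, the set is a sublevel set of `t ^ (q / 2)` plus an affine function,
which is convex as `q / 2 ≥ 1`. For `q = ∞` the weight is constant up to `t = 1` and the Gaussian
density decreases. -/
theorem ordConnected_gaussianPDFReal_le_expPowerWeight (hq : 2 ≤ q) {c : ℝ} (hc : 0 < c)
    {v : NNReal} (hv : v ≠ 0) :
    Set.OrdConnected {t : ℝ | 0 ≤ t ∧ gaussianPDFReal 0 v √t ≤ c * expPowerWeight q √t} := by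
  have hv' : (0 : ℝ) < v := by positivity
  have hg : ∀ t : ℝ, 0 ≤ t → gaussianPDFReal 0 v √t =
      Real.exp (Real.log (√(2 * Real.pi * v))⁻¹ - t / (2 * v)) := by
    intro t ht
    rw [Real.exp_sub, Real.exp_log (by positivity), gaussianPDFReal, sub_zero, Real.sq_sqrt ht,
      neg_div, Real.exp_neg]
    rfl
  by_cases h : q = ∞
  · subst h
    refine ⟨fun a ha b hb t ht => ?_⟩
    have ht0 : 0 ≤ t := ha.1.trans ht.1
    have hb1 : √b ≤ 1 := by
      by_contra hcon
      have := hb.2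
      rw [expPowerWeight_top, abs_of_nonneg (Real.sqrt_nonneg b), if_neg hcon, mul_zero] at this
      exact absurd this (not_le.2 (gaussianPDFReal_pos _ _ _ hv))
    have ht1 : √t ≤ 1 := (Real.sqrt_le_sqrt ht.2).trans hb1
    have ha1 : √a ≤ 1 := (Real.sqrt_le_sqrt ht.1).trans ht1
    refine ⟨ht0, ?_⟩
    have := ha.2
    rw [expPowerWeight_top, abs_of_nonneg (Real.sqrt_nonneg _), if_pos ha1, hg a ha.1] at this
    rw [expPowerWeight_top, abs_of_nonneg (Real.sqrt_nonneg _), if_pos ht1, hg t ht0]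
    refine le_trans ?_ this
    have := ht.1
    gcongr
  · have hQ := two_le_toReal hq h
    have hset : {t : ℝ | 0 ≤ t ∧ gaussianPDFReal 0 v √t ≤ c * expPowerWeight q √t} =
        {t ∈ Set.Ici (0 : ℝ) | t ^ (q.toReal / 2) +
          (Real.log (√(2 * Real.pi * v))⁻¹ - t / (2 * v)) ≤ Real.log c} := by
      ext t
      refine and_congr_right fun ht => ?_
      simp only [expPowerWeight, h, if_false]
      have h1 : |√t| ^ q.toReal = t ^ (q.toReal / 2) := by
        rw [abs_of_nonneg (Real.sqrt_nonneg t), Real.sqrt_eq_rpow, ← Real.rpow_mul ht]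
        congr 1; ring
      rw [hg t ht, h1]
      nth_rw 1 [← Real.exp_log hc]
      rw [← Real.exp_add, Real.exp_le_exp]
      constructor <;> intro <;> linarith
    rw [hset]
    refine (ConvexOn.convex_le ?_ _).ordConnected
    refine (convexOn_rpow (by linarith)).add ⟨convex_Ici 0, fun x _ y _ a b _ _ hab => le_of_eq ?_⟩
    simp only [smul_eq_mul]
    have : b = 1 - a := by linarith
    subst this
    ring

theorem sq_moment_pos {μ : Measure ℝ} [IsProbabilityMeasure μ] [NullSingletonClass μ]
    (h : Integrable (fun x => x ^ 2) μ) : 0 < ∫ x, x ^ 2 ∂μ := by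
  refine lt_of_le_of_ne (integral_nonneg fun x => sq_nonneg x) fun h0 => ?_
  have h1 := (integral_eq_zero_iff_of_nonneg (fun x => sq_nonneg x) h).1 h0.symm
  have h2 : ∀ᵐ x ∂μ, False := by
    filter_upwards [h1, Measure.ae_ne μ 0] with x hx hx0
    exact hx0 (by simpa using hx)
  rw [Filter.eventually_false_iff_eq_bot, ae_eq_bot] at h2
  exact IsProbabilityMeasure.ne_zero μ h2

theorem gaussianReal_sq_moment (v : NNReal) : ∫ x, x ^ 2 ∂(gaussianReal 0 v) = v := by
  have := variance_fun_id_gaussianReal (μ := 0) (v := v)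
  rw [variance_eq_integral (by fun_prop)] at this
  simpa using this

theorem exists_sqConvexLE_gaussianReal (hq : 2 ≤ q) {c : ℝ} (hc : 0 < c) {μ : Measure ℝ}
    [IsProbabilityMeasure μ]
    (hμ : μ = volume.withDensity (fun x => ENNReal.ofReal (c * expPowerWeight q x))) :
    ∃ v : NNReal, v ≠ 0 ∧ ∫ x, x ^ 2 ∂μ = v ∧ SqConvexLE μ (gaussianReal 0 v) := by
  have hμ2 : Integrable (fun x : ℝ => x ^ 2) μ := by
    have := memLp_withDensity_expPowerWeight hq hc 2
    rw [← hμ] at this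
    exact this.integrable_sq
  have hna : NullSingletonClass μ := by
    rw [hμ]
    infer_instance
  have hpos := sq_moment_pos hμ2
  obtain ⟨v, hv⟩ : ∃ v : NNReal, (v : ℝ) = ∫ x, x ^ 2 ∂μ := ⟨⟨_, hpos.le⟩, rfl⟩
  have hv0 : v ≠ 0 := by
    rintro rfl
    simp only [NNReal.coe_zero] at hv
    linarith
  refine ⟨v, hv0, hv.symm, ?_⟩
  refine sqConvexLE_of_ordConnected (measurable_expPowerWeight.const_mul c)
    (fun x => mul_nonneg hc.le (expPowerWeight_nonneg x)) (measurable_gaussianPDFReal 0 v)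
    (gaussianPDFReal_nonneg 0 v) hμ (gaussianReal_of_var_ne_zero _ hv0)
    (fun x => by rw [expPowerWeight_abs]) (fun x => by simp [gaussianPDFReal]) hμ2
    (memLp_id_gaussianReal 2).integrable_sq ?_
    (ordConnected_gaussianPDFReal_le_expPowerWeight hq hc hv0)
  rw [gaussianReal_sq_moment, hv]

end weight

/-! ### Replacing the summands by Gaussians -/

/-- A symmetric unimodal probability measure with finite `p`-th moment. -/
structure SymmUnimodalMoment (p : ℝ) (ν : Measure ℝ) : Prop where
  prob : IsProbabilityMeasure ν
  unimodal : SymmUnimodal ν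
  memLp : MemLp (fun s : ℝ => s) (ENNReal.ofReal p) ν

theorem memLp_id_conv {ν ρ : Measure ℝ} [IsProbabilityMeasure ν] [IsProbabilityMeasure ρ]
    {r : ℝ≥0∞} (hν : MemLp (fun s : ℝ => s) r ν) (hρ : MemLp (fun s : ℝ => s) r ρ) :
    MemLp (fun s : ℝ => s) r (ν ∗ ρ) := by
  rw [Measure.conv, memLp_map_measure_iff (by fun_prop) (by fun_prop)]
  exact (hν.comp_fst ρ).add (hρ.comp_snd ν)

theorem memLp_id_map_const_mul {ν : Measure ℝ} {r : ℝ≥0∞} (hν : MemLp (fun s : ℝ => s) r ν)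
    (a : ℝ) : MemLp (fun s : ℝ => s) r (ν.map (fun x => a * x)) := by
  rw [memLp_map_measure_iff (by fun_prop) (by fun_prop)]
  exact hν.const_mul a

section

variable {p : ℝ} {ν ρ μ γ : Measure ℝ}

theorem SymmUnimodalMoment.conv (hν : SymmUnimodalMoment p ν) (hρ : SymmUnimodalMoment p ρ) :
    SymmUnimodalMoment p (ν ∗ ρ) := by
  have := hν.prob
  have := hρ.prob
  exact ⟨inferInstance, hν.unimodal.conv hρ.unimodal, memLp_id_conv hν.memLp hρ.memLp⟩

theorem SymmUnimodalMoment.map_const_mul (hν : SymmUnimodalMoment p ν) (a : ℝ) :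
    SymmUnimodalMoment p (ν.map (fun x => a * x)) := by
  have := hν.prob
  exact ⟨Measure.isProbabilityMeasure_map (by fun_prop), hν.unimodal.map_const_mul a,
    memLp_id_map_const_mul hν.memLp a⟩

theorem symmUnimodalMoment_gaussianReal (v : NNReal) :
    SymmUnimodalMoment p (gaussianReal 0 v) :=
  ⟨inferInstance, symmUnimodal_gaussianReal_zero v, memLp_id_gaussianReal p.toNNReal⟩

theorem integral_abs_rpow_conv (hp : 0 < p) [IsProbabilityMeasure ν] [IsProbabilityMeasure ρ]
    (hν : MemLp (fun s : ℝ => s) (ENNReal.ofReal p) ν)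
    (hρ : MemLp (fun s : ℝ => s) (ENNReal.ofReal p) ρ) :
    Integrable (fun x => ∫ s, |x + s| ^ p ∂ν) ρ ∧
      ∫ x, |x| ^ p ∂(ν ∗ ρ) = ∫ x, ∫ s, |x + s| ^ p ∂ν ∂ρ := by
  have h := integrable_abs_rpow_of_memLp hp (memLp_id_conv hρ hν)
  refine ⟨?_, ?_⟩
  · have h2 := ((integrable_conv_iff h.1).1 h).2
    refine h2.congr (Filter.Eventually.of_forall fun x => integral_congr_ae
      (Filter.Eventually.of_forall fun s => ?_))
    simp only [Real.norm_eq_abs]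
    exact abs_of_nonneg (by positivity)
  · rw [Measure.conv_comm, integral_conv h]

theorem integral_abs_sqrt_sq_rpow [IsProbabilityMeasure ν] (hν : SymmUnimodal ν) (hp : 0 ≤ p)
    (a x : ℝ) : ∫ s, |√(a ^ 2 * x ^ 2) + s| ^ p ∂ν = ∫ s, |a * x + s| ^ p ∂ν := by
  rw [← mul_pow, Real.sqrt_sq_eq_abs]
  rcases abs_choice (a * x) with h | h <;> rw [h]
  exact integral_abs_rpow_neg hν hp _

theorem moment_conv_map_const_mul (hp : 0 < p) (hν : SymmUnimodalMoment p ν)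
    (hμ : SymmUnimodalMoment p μ) (a : ℝ) :
    Integrable (fun x => ∫ s, |√(a ^ 2 * x ^ 2) + s| ^ p ∂ν) μ ∧
      ∫ x, |x| ^ p ∂(ν ∗ μ.map (fun x => a * x)) =
        ∫ x, ∫ s, |√(a ^ 2 * x ^ 2) + s| ^ p ∂ν ∂μ := by
  have := hν.prob
  have := hμ.prob
  have := (hμ.map_const_mul a).prob
  obtain ⟨h1, h2⟩ := integral_abs_rpow_conv hp hν.memLp (hμ.map_const_mul a).memLp
  simp only [integral_abs_sqrt_sq_rpow hν.unimodal hp.le]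
  rw [integrable_map_measure h1.1 (by fun_prop)] at h1
  refine ⟨h1, ?_⟩
  rw [h2, integral_map (by fun_prop)]
  exact (integral_abs_rpow_conv hp hν.memLp (hμ.map_const_mul a).memLp).1.1

theorem mapsTo_const_mul_Ici {c : ℝ} (hc : 0 ≤ c) :
    (LinearMap.lsmul ℝ ℝ c) ⁻¹' (Set.Ici 0) ⊇ Set.Ici (0 : ℝ) := fun _ ht =>
  mul_nonneg hc ht

theorem moment_conv_le (hp : 2 ≤ p) (hν : SymmUnimodalMoment p ν) (hμ : SymmUnimodalMoment p μ)
    (hγ : SymmUnimodalMoment p γ) (h : SqConvexLE μ γ) (a : ℝ) :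
    ∫ x, |x| ^ p ∂(ν ∗ μ.map (fun x => a * x)) ≤ ∫ x, |x| ^ p ∂(ν ∗ γ.map (fun x => a * x)) := by
  have := hν.prob
  obtain ⟨i1, e1⟩ := moment_conv_map_const_mul (by linarith) hν hμ a
  obtain ⟨i2, e2⟩ := moment_conv_map_const_mul (by linarith) hν hγ a
  rw [e1, e2]
  have hc := ((convexOn_integral_abs_sqrt_rpow hν.unimodal hp hν.memLp).comp_linearMap
    (LinearMap.lsmul ℝ ℝ (a ^ 2))).subset (mapsTo_const_mul_Ici (sq_nonneg a)) (convex_Ici 0)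
  exact h _ hc i1 i2

theorem le_moment_conv (hp : 1 < p) (hp2 : p ≤ 2) (hν : SymmUnimodalMoment p ν)
    (hμ : SymmUnimodalMoment p μ) (hγ : SymmUnimodalMoment p γ) (h : SqConvexLE μ γ) (a : ℝ) :
    ∫ x, |x| ^ p ∂(ν ∗ γ.map (fun x => a * x)) ≤ ∫ x, |x| ^ p ∂(ν ∗ μ.map (fun x => a * x)) := by
  have := hν.prob
  obtain ⟨i1, e1⟩ := moment_conv_map_const_mul (by linarith) hν hμ a
  obtain ⟨i2, e2⟩ := moment_conv_map_const_mul (by linarith) hν hγ a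
  rw [e1, e2]
  have hc := ((concaveOn_integral_abs_sqrt_rpow hν.unimodal hp hp2 hν.memLp).comp_linearMap
    (LinearMap.lsmul ℝ ℝ (a ^ 2))).subset (mapsTo_const_mul_Ici (sq_nonneg a)) (convex_Ici 0)
  -- `SqConvexLE` is applied to the negative of the concave function.
  have := h _ hc.neg i1.neg i2.neg
  simp only [Pi.neg_apply, integral_neg] at this
  exact neg_le_neg_iff.1 this

/-- The law of `∑ i < n, b i * X i` for i.i.d. `X i` with law `μ`. -/
noncomputable def weightedConv (μ : Measure ℝ) (b : ℕ → ℝ) : ℕ → Measure ℝ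
  | 0 => Measure.dirac 0
  | n + 1 => weightedConv μ b n ∗ μ.map (fun x => b n * x)

theorem SymmUnimodalMoment.weightedConv (hμ : SymmUnimodalMoment p μ) (b : ℕ → ℝ) (n : ℕ) :
    SymmUnimodalMoment p (weightedConv μ b n) := by
  induction n with
  | zero =>
    rw [_root_.weightedConv, ← gaussianReal_zero_var]
    exact symmUnimodalMoment_gaussianReal 0
  | succ n ih => exact ih.conv (hμ.map_const_mul _)

/-- The functional `F` is abstract so that one induction serves both directions, with `F` the `p`-th
moment or its negative. -/
theorem weightedConv_le_gaussianReal (hμ : SymmUnimodalMoment p μ) {F : Measure ℝ → ℝ}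
    {v : NNReal} (hF : ∀ ν, SymmUnimodalMoment p ν → ∀ a : ℝ,
      F (ν ∗ μ.map (fun x => a * x)) ≤ F (ν ∗ (gaussianReal 0 v).map (fun x => a * x)))
    (b : ℕ → ℝ) (n : ℕ) :
    F (weightedConv μ b n) ≤
      F (gaussianReal 0 (∑ i ∈ Finset.range n, NNReal.mk (b i ^ 2) (sq_nonneg (b i)) * v)) := by
  -- The induction carries an extra Gaussian factor of variance `w`, which absorbs the summands
  -- already replaced; `w = 0` gives the claim.
  have main : ∀ w : NNReal, F (weightedConv μ b n ∗ gaussianReal 0 w) ≤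
      F (gaussianReal 0 (∑ i ∈ Finset.range n, NNReal.mk (b i ^ 2) (sq_nonneg (b i)) * v + w)) := by
    induction n with
    | zero => intro w; simp [weightedConv]
    | succ n ih =>
      intro w
      have := hμ.prob
      have := (hμ.weightedConv b n).prob
      have := (hμ.map_const_mul (b n)).prob
      calc F (weightedConv μ b (n + 1) ∗ gaussianReal 0 w)
          = F ((weightedConv μ b n ∗ gaussianReal 0 w) ∗ μ.map (fun x => b n * x)) := by
            rw [weightedConv, Measure.conv_assoc, Measure.conv_assoc,
              Measure.conv_comm (gaussianReal 0 w)]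
        _ ≤ F ((weightedConv μ b n ∗ gaussianReal 0 w) ∗
              (gaussianReal 0 v).map (fun x => b n * x)) :=
            hF _ ((hμ.weightedConv b n).conv (symmUnimodalMoment_gaussianReal w)) _
        _ = F (weightedConv μ b n ∗ gaussianReal 0 (w + NNReal.mk (b n ^ 2) (sq_nonneg (b n)) * v)) := by
            rw [gaussianReal_map_const_mul, Measure.conv_assoc, gaussianReal_conv_gaussianReal]
            simp
        _ ≤ _ := ih _
        _ = _ := by
            rw [Finset.sum_range_succ]
            congr 2
            ring
  have h := main 0
  rw [gaussianReal_zero_var, add_zero] at h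
  have := (hμ.weightedConv b n).prob
  rwa [Measure.conv_dirac_zero] at h

end

theorem map_sum_eq_weightedConv {Ω : Type*} [MeasurableSpace Ω] {P : Measure Ω}
    [IsProbabilityMeasure P] {Y : ℕ → Ω → ℝ} (hindep : iIndepFun Y P)
    (hY : ∀ i, AEMeasurable (Y i) P) {μ : Measure ℝ} (hμ : ∀ i, P.map (Y i) = μ)
    (b : ℕ → ℝ) (n : ℕ) :
    P.map (fun ω => ∑ i ∈ Finset.range n, b i * Y i ω) = weightedConv μ b n := by
  induction n with
  | zero => simp [weightedConv]
  | succ n ih =>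
    have hind : iIndepFun (fun i ω => b i * Y i ω) P :=
      hindep.comp (fun i x => b i * x) (fun i => by fun_prop)
    have hm : ∀ i, AEMeasurable (fun ω => b i * Y i ω) P := fun i => (hY i).const_mul _
    have h := hind.indepFun_finsetSum_of_notMem₀ hm (s := Finset.range n) (i := n) (by simp)
    have hs : AEMeasurable (∑ i ∈ Finset.range n, fun ω => b i * Y i ω) P :=
      Finset.aemeasurable_sum _ fun i _ => hm i
    have heq : (fun ω => ∑ i ∈ Finset.range (n + 1), b i * Y i ω) =
        (∑ i ∈ Finset.range n, fun ω => b i * Y i ω) + fun ω => b n * Y n ω := by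
      funext ω
      simp [Finset.sum_range_succ]
    have heq2 : (∑ i ∈ Finset.range n, fun ω => b i * Y i ω) =
        (fun ω => ∑ i ∈ Finset.range n, b i * Y i ω) := by
      funext ω
      simp
    rw [heq, h.map_add_eq_map_conv_map₀ hs (hm n), heq2, ih, weightedConv, ← hμ n,
      AEMeasurable.map_map_of_aemeasurable (by fun_prop) (hY n)]
    rfl

/-! ### Gaussian moments and the limit `p ↓ 1` -/

open Filter Topology

theorem gaussianMoment_two : gaussianMoment 2 = 1 := by
  rw [gaussianMoment_eq_momentNorm 2 two_pos, momentNorm]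
  simp only [Real.rpow_two, sq_abs, gaussianReal_sq_moment]
  simp

theorem gaussianMoment_pos {p : ℝ} (hp : 0 < p) : 0 < gaussianMoment p := by
  have : 0 < Real.Gamma ((p + 1) / 2) := Real.Gamma_pos_of_pos (by linarith)
  unfold gaussianMoment
  positivity

theorem integral_abs_rpow_gaussianReal_one {p : ℝ} (hp : 0 < p) :
    ∫ x, |x| ^ p ∂(gaussianReal 0 1) = gaussianMoment p ^ p := by
  have h : 0 ≤ ∫ x, |x| ^ p ∂(gaussianReal 0 1) := integral_nonneg fun x => by positivity
  rw [gaussianMoment_eq_momentNorm p hp, momentNorm, ← Real.rpow_mul h,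
    one_div_mul_cancel hp.ne', Real.rpow_one]

theorem integral_abs_rpow_gaussianReal {p : ℝ} (hp : 0 < p) (w : NNReal) :
    (∫ x, |x| ^ p ∂(gaussianReal 0 w)) ^ (1 / p) = gaussianMoment p * √w := by
  have h1 : gaussianReal 0 w = (gaussianReal 0 1).map (fun x => √w * x) := by
    rw [gaussianReal_map_const_mul]
    congr 1
    · simp
    · ext
      simp [Real.sq_sqrt]
  have h0 := (gaussianMoment_pos hp).le
  rw [h1, integral_map (by fun_prop) (Measurable.aestronglyMeasurable (by fun_prop))]
  simp only [abs_mul, Real.mul_rpow (abs_nonneg _) (abs_nonneg _)]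
  rw [integral_const_mul, integral_abs_rpow_gaussianReal_one hp, abs_of_nonneg (Real.sqrt_nonneg _),
    ← Real.mul_rpow (by positivity) h0, ← Real.rpow_mul (by positivity),
    mul_one_div_cancel hp.ne', Real.rpow_one, mul_comm]

theorem abs_rpow_le_one_add_sq {p : ℝ} (hp : 1 ≤ p) (hp2 : p ≤ 2) (x : ℝ) :
    |x| ^ p ≤ 1 + x ^ 2 := by
  rcases le_total |x| 1 with hx | hx
  · have := Real.rpow_le_one (abs_nonneg x) hx (by linarith : 0 ≤ p)
    nlinarith [sq_nonneg x]
  · have := Real.rpow_le_rpow_of_exponent_le hx hp2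
    rw [Real.rpow_two, sq_abs] at this
    linarith

theorem tendsto_integral_abs_rpow_one {ρ : Measure ℝ} [IsProbabilityMeasure ρ]
    (hρ : Integrable (fun x => x ^ 2) ρ) :
    Tendsto (fun p : ℝ => ∫ x, |x| ^ p ∂ρ) (𝓝[>] 1) (𝓝 (∫ x, |x| ^ (1 : ℝ) ∂ρ)) := by
  refine tendsto_integral_filter_of_dominated_convergence (fun x => 1 + x ^ 2)
    (Eventually.of_forall fun p => Measurable.aestronglyMeasurable (by fun_prop)) ?_
    ((integrable_const _).add hρ) (Eventually.of_forall fun x => ?_)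
  · filter_upwards [Ioc_mem_nhdsGT (one_lt_two : (1 : ℝ) < 2)] with p hp
    refine Eventually.of_forall fun x => ?_
    rw [Real.norm_of_nonneg (by positivity)]
    exact abs_rpow_le_one_add_sq hp.1.le hp.2 x
  · exact ((Real.continuousAt_const_rpow' one_ne_zero).tendsto).mono_left nhdsWithin_le_nhds

/-! ### Moment comparison for the sums -/

section

variable {q : ℝ≥0∞} {Ω : Type*} [MeasurableSpace Ω] {P : Measure Ω}
  {Y : ℕ → Ω → ℝ}

theorem HasExpPowerDensity.integral_eq_zero {X : Ω → ℝ} (h : HasExpPowerDensity q X P) :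
    ∫ ω, X ω ∂P = 0 := by
  obtain ⟨hX, c, hc, hmap⟩ := h
  have h1 : ∫ ω, X ω ∂P = ∫ x, x * (c * expPowerWeight q x) := by
    rw [← integral_withDensity_ofReal (measurable_expPowerWeight.const_mul c)
      (fun x => mul_nonneg hc.le (expPowerWeight_nonneg x)), ← hmap,
      integral_map hX (by fun_prop)]
  have h2 := integral_neg_eq_self (fun x => x * (c * expPowerWeight q x)) volume
  have h3 : ∀ x : ℝ, expPowerWeight q (-x) = expPowerWeight q x := fun x => by
    rw [← expPowerWeight_abs, abs_neg, expPowerWeight_abs]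
  simp only [h3, neg_mul, integral_neg] at h2
  rw [h1]
  linarith

variable [IsProbabilityMeasure P]

/-- Total mass one determines the normalising constant, so the variables, each given with its own
constant, share one law. -/
theorem withDensity_expPowerWeight_injective {c c' : ℝ} (hc : 0 < c) (hc' : 0 < c')
    [IsProbabilityMeasure (volume.withDensity fun x => ENNReal.ofReal (c * expPowerWeight q x))]
    [IsProbabilityMeasure (volume.withDensity fun x => ENNReal.ofReal (c' * expPowerWeight q x))] :
    c = c' := by
  have key : ∀ c : ℝ, 0 < c → IsProbabilityMeasure
      (volume.withDensity fun x => ENNReal.ofReal (c * expPowerWeight q x)) →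
      ENNReal.ofReal c * ∫⁻ x, ENNReal.ofReal (expPowerWeight q x) = 1 := by
    intro c hc h
    have := h.measure_univ
    rw [withDensity_apply _ MeasurableSet.univ, Measure.restrict_univ] at this
    simp only [ENNReal.ofReal_mul hc.le] at this
    rwa [lintegral_const_mul _ measurable_expPowerWeight.ennreal_ofReal] at this
  have h1 := key c hc inferInstance
  have h2 := key c' hc' inferInstance
  have h3 := ENNReal.eq_inv_of_mul_eq_one_left h1
  have h4 := ENNReal.eq_inv_of_mul_eq_one_left h2
  rwa [← h4, ENNReal.ofReal_eq_ofReal_iff hc.le hc'.le] at h3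

theorem HasExpPowerDensity.map_eq (hdens : ∀ i, HasExpPowerDensity q (Y i) P) :
    ∃ c : ℝ, 0 < c ∧ ∀ i, P.map (Y i) =
      volume.withDensity (fun x => ENNReal.ofReal (c * expPowerWeight q x)) := by
  obtain ⟨h0, c, hc, h⟩ := hdens 0
  refine ⟨c, hc, fun i => ?_⟩
  obtain ⟨h0', c', hc', h'⟩ := hdens i
  have := Measure.isProbabilityMeasure_map (μ := P) h0
  have := Measure.isProbabilityMeasure_map (μ := P) h0'
  rw [h] at *
  rw [h'] at *
  rw [withDensity_expPowerWeight_injective (q := q) hc hc']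

theorem exists_moment_comparison (hq : 2 ≤ q) (hindep : iIndepFun Y P)
    (hdens : ∀ i, HasExpPowerDensity q (Y i) P) :
    ∃ v : NNReal, v ≠ 0 ∧ ∫ ω, Y 0 ω ^ 2 ∂P = v ∧ ∀ (n : ℕ) (a : Fin n → ℝ),
      ∃ w : NNReal, (w : ℝ) = (∑ i, a i ^ 2) * v ∧
      (∀ p : ℝ, 1 ≤ p → Integrable (fun ω => |∑ i, a i * Y i ω| ^ p) P) ∧
      (∀ p : ℝ, 2 ≤ p →
        ∫ ω, |∑ i, a i * Y i ω| ^ p ∂P ≤ ∫ x, |x| ^ p ∂(gaussianReal 0 w)) ∧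
      (∀ p : ℝ, 1 ≤ p → p ≤ 2 →
        ∫ x, |x| ^ p ∂(gaussianReal 0 w) ≤ ∫ ω, |∑ i, a i * Y i ω| ^ p ∂P) := by
  obtain ⟨c, hc, hmap⟩ := HasExpPowerDensity.map_eq hdens
  have hY : ∀ i, AEMeasurable (Y i) P := fun i => (hdens i).1
  set μ := volume.withDensity (fun x => ENNReal.ofReal (c * expPowerWeight q x)) with hμ
  have hprob : IsProbabilityMeasure μ := by
    rw [← hmap 0]
    exact Measure.isProbabilityMeasure_map (hY 0)
  have hμm : ∀ p : ℝ, SymmUnimodalMoment p μ := fun p =>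
    ⟨hprob, symmUnimodal_withDensity_expPowerWeight hc,
      memLp_withDensity_expPowerWeight hq hc p.toNNReal⟩
  obtain ⟨v, hv0, hv, hconv⟩ := exists_sqConvexLE_gaussianReal hq hc hμ
  refine ⟨v, hv0, ?_, fun n a => ?_⟩
  · rw [← hv, ← hmap 0, integral_map (hY 0) (by fun_prop)]
  set b : ℕ → ℝ := fun i => if h : i < n then a ⟨i, h⟩ else 0 with hb
  have hsum : (fun ω => ∑ i, a i * Y i ω) = fun ω => ∑ i ∈ Finset.range n, b i * Y i ω := by
    funext ω
    rw [Finset.sum_range]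
    simp [hb]
  have hlaw := map_sum_eq_weightedConv hindep hY hmap b n
  rw [← hsum] at hlaw
  have hS : AEMeasurable (fun ω => ∑ i, a i * Y i ω) P :=
    Finset.aemeasurable_fun_sum _ fun i _ => (hY i).const_mul _
  have hint : ∀ p : ℝ, ∫ ω, |∑ i, a i * Y i ω| ^ p ∂P =
      ∫ x, |x| ^ p ∂(weightedConv μ b n) := by
    intro p
    rw [← hlaw, integral_map hS (Measurable.aestronglyMeasurable (by fun_prop))]
  have hlow : ∀ p : ℝ, 1 < p → p ≤ 2 → ∫ x, |x| ^ p ∂(gaussianReal 0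
      (∑ i ∈ Finset.range n, NNReal.mk (b i ^ 2) (sq_nonneg (b i)) * v)) ≤
        ∫ x, |x| ^ p ∂(weightedConv μ b n) := by
    intro p hp hp2
    have := weightedConv_le_gaussianReal (hμm p) (F := fun ν => -∫ x, |x| ^ p ∂ν) (v := v)
      (fun ν hν a => neg_le_neg (le_moment_conv hp hp2 hν (hμm p)
        (symmUnimodalMoment_gaussianReal v) hconv a)) b n
    exact neg_le_neg_iff.1 this
  refine ⟨∑ i ∈ Finset.range n, NNReal.mk (b i ^ 2) (sq_nonneg (b i)) * v, ?_, fun p hp => ?_,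
    fun p hp => ?_, fun p hp hp2 => ?_⟩
  · push_cast
    rw [← Finset.sum_mul, Finset.sum_range]
    simp [hb]
  · have := integrable_abs_rpow_of_memLp (by linarith) ((hμm p).weightedConv b n).memLp
    rw [← hlaw] at this
    exact this.comp_aemeasurable hS
  · rw [hint]
    exact weightedConv_le_gaussianReal (hμm p) (F := fun ν => ∫ x, |x| ^ p ∂ν)
      (fun ν hν a => moment_conv_le hp hν (hμm p) (symmUnimodalMoment_gaussianReal v) hconv a) b n
  · rw [hint]
    -- At `p = 1` the function `|u| ^ (p - 2)` is not integrable near `0`, so this case is a limit,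
    -- dominated by `1 + x ^ 2`.
    rcases hp.eq_or_lt with rfl | hp
    · have hm := (hμm 2).weightedConv b n
      have := hm.prob
      have h2 := hm.memLp
      rw [show ENNReal.ofReal 2 = 2 by simp] at h2
      refine le_of_tendsto_of_tendsto
        (tendsto_integral_abs_rpow_one (memLp_id_gaussianReal 2).integrable_sq)
        (tendsto_integral_abs_rpow_one h2.integrable_sq) ?_
      filter_upwards [Ioc_mem_nhdsGT (one_lt_two : (1 : ℝ) < 2)] with p hp
      exact hlow p hp.1 hp.2
    · exact hlow p hp hp2

/-! ### Sharpness through the central limit theorem -/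

/-- Weak convergence alone gives `∫ G ≤ liminf` for continuous `G ≥ 0`, by the portmanteau
inequality on open sets; no uniform integrability is needed. -/
theorem lintegral_gaussianReal_le_of_clt {X : ℕ → Ω → ℝ} (hindep : iIndepFun X P)
    (hident : ∀ i, IdentDistrib (X i) (X 0) P P) (h0 : P[X 0] = 0) (h1 : P[X 0 ^ 2] = 1)
    {G : ℝ → ℝ} (hG : Continuous G) (hG0 : 0 ≤ G) {B : ℝ≥0∞}
    (hB : ∀ n : ℕ, 1 ≤ n →
      ∫⁻ ω, ENNReal.ofReal (G ((√n)⁻¹ * ∑ k ∈ Finset.range n, X k ω)) ∂P ≤ B) :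
    ∫⁻ x, ENNReal.ofReal (G x) ∂(gaussianReal 0 1) ≤ B := by
  have hclt := tendstoInDistribution_inv_sqrt_mul_sum (P' := gaussianReal 0 1) (Y := id)
    ⟨by fun_prop, by simp⟩ h0 h1 hindep hident
  have hm := hclt.forall_aemeasurable
  have h := lintegral_le_liminf_lintegral_of_forall_isOpen_measure_le_liminf_measure
    (μ := gaussianReal 0 1) hG hG0 fun U hU => by
      have := ProbabilityMeasure.le_liminf_measure_open_of_tendsto hclt.tendsto hU
      simpa using this
  refine h.trans (liminf_le_of_frequently_le' (Eventually.frequently ?_))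
  filter_upwards [eventually_ge_atTop 1] with n hn
  refine le_trans (le_of_eq ?_) (hB n hn)
  rw [lintegral_map' (Measurable.aemeasurable (by fun_prop)) (hm n)]

end

/-- The extremal weights are all equal to `1 / √(n v)`, which normalises the sum to variance one. -/
theorem lintegral_gaussianReal_le_of_sum {q : ℝ≥0∞} {Ω : Type*} [MeasurableSpace Ω]
    {P : Measure Ω} [IsProbabilityMeasure P] {Y : ℕ → Ω → ℝ} (hindep : iIndepFun Y P)
    (hdens : ∀ i, HasExpPowerDensity q (Y i) P) {v : NNReal} (hv0 : v ≠ 0)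
    (hv : ∫ ω, Y 0 ω ^ 2 ∂P = v) {G : ℝ → ℝ} (hG : Continuous G) (hG0 : 0 ≤ G) {B : ℝ≥0∞}
    (hB : ∀ n : ℕ, 1 ≤ n → ∀ a : Fin n → ℝ, (∑ i, a i ^ 2) * v = 1 →
      ∫⁻ ω, ENNReal.ofReal (G (∑ i, a i * Y i ω)) ∂P ≤ B) :
    ∫⁻ x, ENNReal.ofReal (G x) ∂(gaussianReal 0 1) ≤ B := by
  have hvpos : (0 : ℝ) < v := by positivity
  obtain ⟨c, hc, hmap⟩ := HasExpPowerDensity.map_eq hdens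
  refine lintegral_gaussianReal_le_of_clt (X := fun i ω => (√v)⁻¹ * Y i ω)
    (hindep.comp (fun _ x => (√v)⁻¹ * x) (fun _ => by fun_prop)) (fun i => ?_) ?_ ?_ hG hG0
    fun n hn => ?_
  · have : IdentDistrib (Y i) (Y 0) P P := ⟨(hdens i).1, (hdens 0).1, by rw [hmap, hmap]⟩
    exact this.comp (u := fun x => (√v)⁻¹ * x) (by fun_prop)
  · rw [integral_const_mul, (hdens 0).integral_eq_zero, mul_zero]
  · simp only [Pi.pow_apply, mul_pow]
    rw [integral_const_mul, hv, inv_pow, Real.sq_sqrt hvpos.le, inv_mul_cancel₀ hvpos.ne']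
  · refine le_trans (le_of_eq ?_) (hB n hn (fun _ => (√n)⁻¹ * (√v)⁻¹) ?_)
    · refine lintegral_congr fun ω => ?_
      rw [Finset.sum_range, Finset.mul_sum]
      simp only [mul_assoc]
    · have hn' : (0 : ℝ) < n := by exact_mod_cast hn
      simp only [mul_pow, inv_pow, Real.sq_sqrt hvpos.le, Real.sq_sqrt hn'.le, Finset.sum_const,
        Finset.card_univ, Fintype.card_fin, nsmul_eq_mul]
      field_simp

theorem integral_one_add_sq_sub_abs_rpow_gaussianReal {p : ℝ} (hp : 1 ≤ p) :
    Integrable (fun x => 1 + x ^ 2 - |x| ^ p) (gaussianReal 0 1) ∧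
    ∫ x, (1 + x ^ 2 - |x| ^ p) ∂(gaussianReal 0 1) = 2 - gaussianMoment p ^ p := by
  have i1 : Integrable (fun x : ℝ => x ^ 2) (gaussianReal 0 1) :=
    (memLp_id_gaussianReal 2).integrable_sq
  have i2 : Integrable (fun x : ℝ => 1 + x ^ 2) (gaussianReal 0 1) := (integrable_const _).add i1
  have i3 : Integrable (fun x : ℝ => |x| ^ p) (gaussianReal 0 1) :=
    integrable_abs_rpow_of_memLp (by linarith) (symmUnimodalMoment_gaussianReal 1).memLp
  refine ⟨i2.sub i3, ?_⟩
  rw [integral_sub i2 i3, integral_add (integrable_const _) i1, gaussianReal_sq_moment,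
    integral_abs_rpow_gaussianReal_one (by linarith)]
  norm_num

theorem mainTheorem3 (q : ℝ≥0∞) (hq : 2 ≤ q)
    {Ω : Type*} [MeasurableSpace Ω] (P : Measure Ω) [IsProbabilityMeasure P]
    (Y : ℕ → Ω → ℝ) (hindep : iIndepFun Y P) (hdens : ∀ i, HasExpPowerDensity q (Y i) P) :
    (∀ p : ℝ, 1 ≤ p → ∀ n : ℕ, 1 ≤ n → ∀ a : Fin n → ℝ,
      Integrable (fun ω => |∑ i, a i * Y i ω| ^ p) P) ∧
    (∀ p : ℝ, 2 ≤ p →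
      IsLeast {C : ℝ | ∀ n : ℕ, 1 ≤ n → ∀ a : Fin n → ℝ,
        momentNorm p (fun ω => ∑ i, a i * Y i ω) P ≤
          C * momentNorm 2 (fun ω => ∑ i, a i * Y i ω) P}
        (gaussianMoment p)) ∧
    (∀ p : ℝ, 1 ≤ p → p ≤ 2 →
      IsGreatest {C : ℝ | ∀ n : ℕ, 1 ≤ n → ∀ a : Fin n → ℝ,
        C * momentNorm 2 (fun ω => ∑ i, a i * Y i ω) P ≤
          momentNorm p (fun ω => ∑ i, a i * Y i ω) P}
        (gaussianMoment p)) := by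
  obtain ⟨v, hv0, hv, hcomp⟩ := exists_moment_comparison hq hindep hdens
  have hnorm2 : ∀ (n : ℕ) (a : Fin n → ℝ), momentNorm 2 (fun ω => ∑ i, a i * Y i ω) P =
      √((∑ i, a i ^ 2) * v) := by
    intro n a
    obtain ⟨w, hw, -, hup, hlow⟩ := hcomp n a
    -- At `p = 2` the upper and lower comparisons both apply, so the second moment is exactly the
    -- Gaussian one.
    rw [momentNorm, le_antisymm (hup 2 le_rfl) (hlow 2 one_le_two le_rfl),
      integral_abs_rpow_gaussianReal two_pos, gaussianMoment_two, one_mul, hw]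
  have hint : ∀ p : ℝ, 1 ≤ p → ∀ (n : ℕ) (a : Fin n → ℝ),
      Integrable (fun ω => |∑ i, a i * Y i ω| ^ p) P := fun p hp n a =>
    (hcomp n a).choose_spec.2.1 p hp
  have hmom : ∀ p : ℝ, 1 ≤ p → ∀ (n : ℕ) (a : Fin n → ℝ),
      ∫ ω, |∑ i, a i * Y i ω| ^ p ∂P = momentNorm p (fun ω => ∑ i, a i * Y i ω) P ^ p := by
    intro p hp n a
    rw [momentNorm, ← Real.rpow_mul (integral_nonneg fun ω => by positivity),
      one_div_mul_cancel (by linarith), Real.rpow_one]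
  have hnn : ∀ (p : ℝ) (n : ℕ) (a : Fin n → ℝ),
      0 ≤ momentNorm p (fun ω => ∑ i, a i * Y i ω) P := fun p n a =>
    Real.rpow_nonneg (integral_nonneg fun ω => by positivity) _
  have hexists : ∃ a : Fin 1 → ℝ, (∑ i, a i ^ 2) * (v : ℝ) = 1 := by
    have hvpos : (0 : ℝ) < v := by positivity
    exact ⟨fun _ => √(v : ℝ)⁻¹, by simp [hvpos.ne']⟩
  refine ⟨fun p hp n _ a => hint p hp n a, fun p hp => ⟨fun n _ a => ?_, fun C hC => ?_⟩,
    fun p hp hp2 => ⟨fun n _ a => ?_, fun C hC => ?_⟩⟩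
  · obtain ⟨w, hw, -, hup, -⟩ := hcomp n a
    rw [hnorm2, ← hw, ← integral_abs_rpow_gaussianReal (by linarith), momentNorm]
    exact Real.rpow_le_rpow (integral_nonneg fun ω => by positivity) (hup p hp) (by positivity)
  · have hp0 : 0 < p := by linarith
    have hC' : ∀ n : ℕ, 1 ≤ n → ∀ a : Fin n → ℝ, (∑ i, a i ^ 2) * (v : ℝ) = 1 →
        momentNorm p (fun ω => ∑ i, a i * Y i ω) P ≤ C := by
      intro n hn a ha
      have := hC n hn a
      rwa [hnorm2, ha, Real.sqrt_one, mul_one] at this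
    have hC0 : 0 ≤ C := by
      obtain ⟨a, ha⟩ := hexists
      exact (hnn p 1 a).trans (hC' 1 le_rfl a ha)
    have h := lintegral_gaussianReal_le_of_sum hindep hdens hv0 hv (G := fun x => |x| ^ p)
      (continuous_abs.rpow_const fun _ => Or.inr hp0.le) (fun x => by positivity)
      (B := ENNReal.ofReal (C ^ p)) fun n hn a ha => by
        rw [← ofReal_integral_eq_lintegral_ofReal (hint p (by linarith) n a)
          (Eventually.of_forall fun ω => by positivity), hmom p (by linarith)]
        exact ENNReal.ofReal_le_ofReal (Real.rpow_le_rpow (hnn p n a) (hC' n hn a ha) hp0.le)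
    rw [← ofReal_integral_eq_lintegral_ofReal (integrable_abs_rpow_of_memLp hp0
      (symmUnimodalMoment_gaussianReal 1).memLp) (Eventually.of_forall fun ω => by positivity),
      integral_abs_rpow_gaussianReal_one hp0, ENNReal.ofReal_le_ofReal_iff (by positivity),
      Real.rpow_le_rpow_iff (gaussianMoment_pos hp0).le hC0 hp0] at h
    exact h
  · obtain ⟨w, hw, -, -, hlow⟩ := hcomp n a
    rw [hnorm2, ← hw, ← integral_abs_rpow_gaussianReal (by linarith), momentNorm]
    exact Real.rpow_le_rpow (integral_nonneg fun ω => by positivity) (hlow p hp hp2)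
      (by positivity)
  · have hp0 : 0 < p := by linarith
    have hγ := gaussianMoment_pos hp0
    rcases le_or_gt C 0 with hC0 | hC0
    · exact hC0.trans hγ.le
    have hsub : ∀ n : ℕ, 1 ≤ n → ∀ a : Fin n → ℝ, (∑ i, a i ^ 2) * (v : ℝ) = 1 →
        Integrable (fun ω => 1 + (∑ i, a i * Y i ω) ^ 2 - |∑ i, a i * Y i ω| ^ p) P ∧
        ∫ ω, (1 + (∑ i, a i * Y i ω) ^ 2 - |∑ i, a i * Y i ω| ^ p) ∂P ≤ 2 - C ^ p := by
      intro n hn a ha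
      have h1 := hC n hn a
      have h2 := hmom 2 one_le_two n a
      have i2 := hint 2 one_le_two n a
      rw [hnorm2, ha, Real.sqrt_one] at h1 h2
      rw [mul_one] at h1
      simp only [Real.rpow_two, sq_abs] at h2 i2
      have i3 := hint p hp n a
      have i12 : Integrable (fun ω => 1 + (∑ i, a i * Y i ω) ^ 2) P := (integrable_const _).add i2
      refine ⟨i12.sub i3, ?_⟩
      rw [integral_sub i12 i3, integral_add (integrable_const _) i2, h2, hmom p hp]
      have := Real.rpow_le_rpow hC0.le h1 hp0.le
      simp only [integral_const, probReal_univ, smul_eq_mul]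
      linarith
    -- The Fatou-type inequality bounds Gaussian integrals from above, while a lower bound on
    -- `gaussianMoment p` is not wanted here. It is therefore applied to `1 + x ^ 2 - |x| ^ p ≥ 0`,
    -- whose quadratic part has the same mean for the normalised sums and for the Gaussian.
    have h := lintegral_gaussianReal_le_of_sum hindep hdens hv0 hv
      (G := fun x => 1 + x ^ 2 - |x| ^ p)
      ((continuous_const.add (continuous_pow 2)).sub
        (continuous_abs.rpow_const fun _ => Or.inr hp0.le))
      (fun x => sub_nonneg.2 (abs_rpow_le_one_add_sq hp hp2 x))
      (B := ENNReal.ofReal (2 - C ^ p)) fun n hn a ha => by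
        rw [← ofReal_integral_eq_lintegral_ofReal (hsub n hn a ha).1
          (Eventually.of_forall fun ω => sub_nonneg.2 (abs_rpow_le_one_add_sq hp hp2 _))]
        exact ENNReal.ofReal_le_ofReal (hsub n hn a ha).2
    obtain ⟨i1, e1⟩ := integral_one_add_sq_sub_abs_rpow_gaussianReal hp
    -- Nonnegativity must be known before removing `ENNReal.ofReal`, which truncates at `0`; a
    -- single normalised summand shows it.
    have hB : 0 ≤ 2 - C ^ p := by
      obtain ⟨a, ha⟩ := hexists
      exact (integral_nonneg fun ω => sub_nonneg.2 (abs_rpow_le_one_add_sq hp hp2 _)).trans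
        (hsub 1 le_rfl a ha).2
    rw [← ofReal_integral_eq_lintegral_ofReal i1
      (Eventually.of_forall fun x => sub_nonneg.2 (abs_rpow_le_one_add_sq hp hp2 x)), e1,
      ENNReal.ofReal_le_ofReal_iff hB] at h
    exact (Real.rpow_le_rpow_iff hC0.le hγ.le hp0).1 (by linarith)
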